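/- Let $\hbar>0$. For a pure state, i.e. a unit vector $\psi\in L^2(\mathbb R)$, with momentum wave function $\phi(p)=\frac1{\sqrt{2\pi\hbar}}\int e^{-ipx/\hbar}\psi(x)\,dx$ (the $L^2$ Fourier transform), define for $\theta\in(0,1]$ $$\Delta^c x(\theta)=\inf\Big\{|X|: X\subseteq\mathbb R\text{ Lebesgue measurable},\ \int_X|\psi|^2\,dx\ge\theta\Big\},\qquad \Delta^I x(\theta)=\inf\Big\{x_2-x_1: \int_{x_1}^{x_2}|\psi|^2\,dx\ge\theta\Big\},$$ with values in $[0,\infty]$ ($\inf\emptyset=\infty$), and define $\Delta^c p(\theta)$, $\Delta^I p(\theta)$ in the same way from $\phi$. For $c\ge 0$ let $\lambda_0(c)$ be the largest eigenvalue of the operator $(K_cf)(u)=\int_{-1}^1\frac{\sin c(u-v)}{\pi(u-v)}f(v)\,dv$ on $L^2[-1,1]$. Then this largest eigenvalue exists, and $\lambda_0$ is a strictly increasing bijection from $[0,\infty)$ onto $[0,1)$; let $\lambda_0^{-1}:[0,1)\to[0,\infty)$ be its inverse and put $\lambda_0^{-1}(1)=\infty$. Let $\theta_x,\theta_p\in(0,1]$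 with $\theta_x+\theta_p>1$ and put $T=\bigl(\sqrt{\theta_x\theta_p}-\sqrt{(1-\theta_x)(1-\theta_p)}\bigr)^2$. For every pure state: 1. $\Delta^c x(\theta_x)\cdot\Delta^c p(\theta_p)\ge 2\pi\hbar\,T$. 2. If $\Delta^I x(\theta_x)\cdot\Delta^I p(\theta_p)<\infty$, then $\lambda_0\!\left(\dfrac{\Delta^I x(\theta_x)\,\Delta^I p(\theta_p)}{4\hbar}\right)\ge T$. 3. Equivalently, and in all cases, $\Delta^I x(\theta_x)\cdot\Delta^I p(\theta_p)\ge 4\hbar\,\lambda_0^{-1}(T)$. The bound 3 is saturated by superpositions built from the leading prolate-spheroidal function: let $L,W>0$ with $LW=4\hbar\,\lambda_0^{-1}(T)$ (so $\theta_x,\theta_p$ are not both $1$), let $f$ be any normalized eigenfunction of $K_{LW/(4\hbar)}$ with eigenvalue $\lambda_0(LW/(4\hbar))$, let $e(x)=\sqrt{2/L}\,f(2x/L)$ for $|x|\le L/2$ and $e(x)=0$ otherwise, and let $g$ be the orthogonal projection of $e$ onto the states whose momentum is supported in $[-W/2,W/2]$. Then there is a unit vector $e^\perp\perp e$ in the span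 of $e$ and $g$ such that the state $\psi=\sqrt{\theta_x}\,e+\sqrt{1-\theta_x}\,e^\perp$ is normalized and satisfies $\Delta^I x(\theta_x)=L$ and $\Delta^I p(\theta_p)=W$, hence $\Delta^I x(\theta_x)\cdot\Delta^I p(\theta_p)=4\hbar\,\lambda_0^{-1}(T)$. For $\theta_x=1$ this is the leading prolate-spheroidal function itself. -/

import Mathlib

open MeasureTheory Set
open scoped ENNReal NNReal FourierTransform

noncomputable section

namespace ConfidenceUncertainty

/-- The Hilbert space `L²(ℝ)` of wave functions; pure states are its unit vectors. -/
abbrev L2R : Type := Lp ℂ 2 (volume : Measure ℝ)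

/-- The momentum-space wave function
`φ(p) = (2πħ)^(-1/2) ∫ exp(-i p x / ħ) ψ(x) dx`, understood as the (Plancherel) Fourier transform
on `L²(ℝ)`. Mathlib's transform is `𝓕 ψ (ξ) = ∫ exp(-2πi x ξ) ψ(x) dx`, whence the rescaling. -/
def momentumWave (hbar : ℝ) (ψ : L2R) (p : ℝ) : ℂ :=
  ((1 / √(2 * Real.pi * hbar) : ℝ) : ℂ) * (𝓕 ψ : L2R) (p / (2 * Real.pi * hbar))

/-- The infimum of the Lebesgue measures of the Lebesgue measurable sets `X` with
`∫_X |w|² ≥ θ`, with value `∞` when there is no such set of finite measure. -/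
def confidenceWidth (w : ℝ → ℂ) (θ : ℝ) : ℝ≥0∞ :=
  ⨅ (X : Set ℝ) (_ : NullMeasurableSet X volume) (_ : θ ≤ ∫ x in X, ‖w x‖ ^ 2), volume X

/-- The infimum of the lengths of the bounded intervals `[x₁, x₂]` with
`∫_{x₁}^{x₂} |w|² ≥ θ`, with value `∞` when there is no such interval. -/
def intervalWidth (w : ℝ → ℂ) (θ : ℝ) : ℝ≥0∞ :=
  ⨅ (x₁ : ℝ) (x₂ : ℝ) (_ : x₁ ≤ x₂) (_ : θ ≤ ∫ x in Icc x₁ x₂, ‖w x‖ ^ 2),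
    ENNReal.ofReal (x₂ - x₁)

/-- Confidence uncertainty of position. -/
def confX (ψ : L2R) (θ : ℝ) : ℝ≥0∞ := confidenceWidth ψ θ

/-- Confidence uncertainty of momentum. -/
def confP (hbar : ℝ) (ψ : L2R) (θ : ℝ) : ℝ≥0∞ := confidenceWidth (momentumWave hbar ψ) θ

/-- Interval confidence uncertainty of position. -/
def intX (ψ : L2R) (θ : ℝ) : ℝ≥0∞ := intervalWidth ψ θ

/-- Interval confidence uncertainty of momentum. -/
def intP (hbar : ℝ) (ψ : L2R) (θ : ℝ) : ℝ≥0∞ := intervalWidth (momentumWave hbar ψ) θ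

/-- The angular target `(√(θ_x θ_p) - √((1 - θ_x)(1 - θ_p)))²`. -/
def angularTarget (θx θp : ℝ) : ℝ := (√(θx * θp) - √((1 - θx) * (1 - θp))) ^ 2

/-- The Hilbert space `L²[-1,1]`. -/
abbrev L2I : Type := Lp ℂ 2 (volume.restrict (Icc (-1 : ℝ) 1))

/-- The kernel `sin (c (u - v)) / (π (u - v))`, with its limit value `c / π` at `u = v`. -/
def sincKernel (c u v : ℝ) : ℝ := c / Real.pi * Real.sinc (c * (u - v))

/-- `f` is an eigenfunction, with eigenvalue `lam`, of the prolate-spheroidal integral operator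
`(K_c f)(u) = ∫_{-1}^{1} sin (c (u - v)) / (π (u - v)) f(v) dv` on `L²[-1,1]`. -/
def IsSlepianEigenfunction (c lam : ℝ) (f : L2I) : Prop :=
  f ≠ 0 ∧ ∀ᵐ u ∂(volume.restrict (Icc (-1 : ℝ) 1)),
    ∫ v in Icc (-1 : ℝ) 1, (sincKernel c u v : ℂ) * f v = (lam : ℂ) * f u

/-- The set of eigenvalues of `K_c` (which is self-adjoint, so that they are real). -/
def slepianEigenvalues (c : ℝ) : Set ℝ := {lam | ∃ f : L2I, IsSlepianEigenfunction c lam f}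

/-- The largest eigenvalue `λ₀(c)` of `K_c`. -/
def lambda0 (c : ℝ) : ℝ := sSup (slepianEigenvalues c)

/-- The inverse function of `λ₀ : [0,∞) → [0,1)`, extended by `λ₀⁻¹(1) = ∞`
(the infimum of the empty set): the least `c` with `λ₀(c) ≥ t`. -/
def lambda0Inv (t : ℝ) : ℝ≥0∞ := ⨅ (c : ℝ≥0) (_ : t ≤ lambda0 c), (c : ℝ≥0∞)

/-- `e` is the function `f` on `[-1,1]` carried to `[-L/2, L/2]` by the unitary rescaling and
extended by zero to the line. -/
def IsRescaled (L : ℝ) (f : L2I) (e : L2R) : Prop :=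
  ∀ᵐ x : ℝ, e x =
    (Icc (-(L / 2)) (L / 2)).indicator (fun x => ((√(2 / L) : ℝ) : ℂ) * f (2 * x / L)) x

/-- `g` is the orthogonal projection of `e` on the states whose momentum lies in
`[-W/2, W/2]`. -/
def IsBandProjection (hbar W : ℝ) (e g : L2R) : Prop :=
  ∀ᵐ p : ℝ, momentumWave hbar g p =
    (Icc (-(W / 2)) (W / 2)).indicator (momentumWave hbar e) p

/-- `ψ` is a superposition `√θ e + √(1-θ) e'` of `e`, the principal eigenfunction `f` rescaled to
`[-L/2, L/2]`, and a unit vector `e'` orthogonal to `e` in the span of `e` and its projection on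
the momentum band `[-W/2, W/2]`. -/
def IsSlepianSuperposition (hbar L W θ : ℝ) (f : L2I) (ψ : L2R) : Prop :=
  ∃ e g e' : L2R, IsRescaled L f e ∧ IsBandProjection hbar W e g ∧
    e' ∈ Submodule.span ℂ {e, g} ∧ ‖e'‖ = 1 ∧ inner ℂ e e' = 0 ∧
    ψ = ((√θ : ℝ) : ℂ) • e + ((√(1 - θ) : ℝ) : ℂ) • e'

end ConfidenceUncertainty

end

noncomputable section

namespace ConfidenceUncertainty

open Filter Topology ComplexConjugate

/-! Let `P` cut a state to a position set, `Q` to a momentum set, and let `h = Pψ`, `k = Qψ`. Both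
bounds follow from one geometric fact, the Landau–Pollak inequality
(`angularTarget_le_of_projections`). If `‖h‖² ≥ θx` and `‖k‖² ≥ θp`, then `ψ` makes angles at most
`arccos √θx` and `arccos √θp` with the two ranges. These angles add up to less than `π/2` exactly
because `θx + θp > 1`, so the ranges contain vectors whose angle has squared cosine at least `T`.
Hence `T ≤ μ` whenever every `v` in the range of `P` satisfies `‖Qv‖² ≤ μ‖v‖²`.

It remains to bound `μ`. For sets of finite measure, Cauchy–Schwarz bounds the Fourier transform of
`v` pointwise and `μ = |X||P|/(2πħ)` will do (`norm_fourier_sq_le_of_support`). For intervals,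
translation, modulation and dilation reduce to `[-1,1]` and a centred band `[-c,c]`
(`IsPullback.setIntegral_fourier`), where the best `μ` is the maximum of the quadratic form
`concentration c` on the unit sphere. This form is that of `K_c`, and weak compactness makes the
maximum attained, so it equals `λ₀(c)` (`exists_concentration_eq_lambda0`). Monotonicity, continuity
and the range of `λ₀` are read off from the variational description; strictness comes from
analyticity of the Fourier transform of a compactly supported function.

For saturation, the leading eigenfunction `e` satisfies `Qe = g` and `Pg = Te`. The plane spanned by
`e` and `g` is thus invariant under both projections, and the angle inequality becomes an equality
for a suitably rotated vector in it. That vector has the required masses in intervals of lengths `L`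
and `W`; the lower bound on the product then leaves no room for either width to be smaller. -/

open scoped SchwartzMap ContDiff in
/-- On `L¹ ∩ L²`, the Plancherel transform is given by the Fourier integral. -/
theorem fourier_ae_eq_of_integrable (f : L2R) (hf : Integrable f) :
    (𝓕 f : L2R) =ᵐ[volume] 𝓕 (f : ℝ → ℂ) := by
  have hcont : Continuous (𝓕 (f : ℝ → ℂ)) :=
    VectorFourier.fourierIntegral_continuous (μ := (volume : Measure ℝ))
      Real.continuous_fourierChar (L := innerₗ ℝ) (by fun_prop) hf
  -- Both sides are tested against smooth compactly supported functions; in each case the transform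
  -- moves onto the test function, by definition for tempered distributions and by Fubini for the
  -- integral.
  refine ae_eq_of_integral_contDiff_smul_eq ?_ hcont.locallyIntegrable ?_
  · exact (Lp.memLp _).locallyIntegrable (by norm_num)
  intro g g_smooth g_cpt
  have hg₁ : HasCompactSupport (Complex.ofRealCLM ∘ g) := g_cpt.comp_left rfl
  have hg₂ : ContDiff ℝ ∞ (Complex.ofRealCLM ∘ g) := by fun_prop
  let G : 𝓢(ℝ, ℂ) := hg₁.toSchwartzMap hg₂
  have h1 := congrArg (fun T => T G) (Lp.fourier_toTemperedDistribution_eq f)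
  simp only [TemperedDistribution.fourier_apply, Lp.toTemperedDistribution_apply] at h1
  have h2 := VectorFourier.integral_fourierIntegral_smul_eq_flip (μ := (volume : Measure ℝ))
    (ν := (volume : Measure ℝ)) (L := innerₗ ℝ) (e := Real.fourierChar) (f := (G : ℝ → ℂ))
    (g := (f : ℝ → ℂ)) Real.continuous_fourierChar (by fun_prop) G.integrable hf
  rw [flip_innerₗ] at h2
  have h3 : ∫ x, (𝓕 G) x • f x = ∫ x, G x • 𝓕 (f : ℝ → ℂ) x := by
    rw [SchwartzMap.fourier_coe]
    exact h2
  have h4 : ∀ F : ℝ → ℂ, ∫ x, g x • F x = ∫ x, G x • F x := fun F => rfl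
  rw [h4, h4, ← h3, h1]

/-! ### Restriction to a set as an orthogonal projection of L² -/

section L2

variable {α : Type*} [MeasurableSpace α] {μ : Measure α}

theorem norm_sq_eq_integral (f : Lp ℂ 2 μ) : ‖f‖ ^ 2 = ∫ x, ‖f x‖ ^ 2 ∂μ := by
  have h := @inner_self_eq_norm_sq ℂ _ _ _ _ f
  rw [← h, L2.inner_def, ← integral_re (L2.integrable_inner f f)]
  refine integral_congr_ae (.of_forall fun x => ?_)
  exact inner_self_eq_norm_sq (𝕜 := ℂ) (f x)

theorem integrable_norm_sq (f : Lp ℂ 2 μ) : Integrable (fun x => ‖f x‖ ^ 2) μ :=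
  (memLp_two_iff_integrable_sq_norm (Lp.aestronglyMeasurable f)).1 (Lp.memLp f)

/-- Restriction of an `L²` function to a measurable set. -/
theorem exists_indicator {S : Set α} (hS : NullMeasurableSet S μ) (f : Lp ℂ 2 μ) :
    ∃ h : Lp ℂ 2 μ, h =ᵐ[μ] S.indicator f := by
  obtain ⟨S', -, hS', hSS'⟩ := hS.exists_measurable_subset_ae_eq
  exact ⟨((Lp.memLp f).indicator hS').toLp _, (MemLp.coeFn_toLp _).trans
    (indicator_ae_eq_of_ae_eq_set hSS')⟩

theorem inner_indicator_left {S : Set α} {f h : Lp ℂ 2 μ} (hS : NullMeasurableSet S μ)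
    (hh : h =ᵐ[μ] S.indicator f) (g : Lp ℂ 2 μ) :
    inner ℂ h g = ∫ x in S, inner ℂ (f x) (g x) ∂μ := by
  rw [L2.inner_def, ← integral_indicator₀ hS]
  refine integral_congr_ae ?_
  filter_upwards [hh] with x hx
  rw [hx]
  by_cases h : x ∈ S <;> simp [h]

theorem norm_sq_indicator {S : Set α} {f h : Lp ℂ 2 μ} (hS : NullMeasurableSet S μ)
    (hh : h =ᵐ[μ] S.indicator f) : ‖h‖ ^ 2 = ∫ x in S, ‖f x‖ ^ 2 ∂μ := by
  rw [norm_sq_eq_integral, ← integral_indicator₀ hS]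
  refine integral_congr_ae ?_
  filter_upwards [hh] with x hx
  rw [hx]
  by_cases h : x ∈ S <;> simp [h]

theorem inner_indicator_self {S : Set α} {f h : Lp ℂ 2 μ} (hS : NullMeasurableSet S μ)
    (hh : h =ᵐ[μ] S.indicator f) : inner ℂ h f = ((‖h‖ ^ 2 : ℝ) : ℂ) := by
  rw [inner_indicator_left hS hh, norm_sq_indicator hS hh, ← integral_complex_ofReal]
  refine integral_congr_ae (.of_forall fun x => ?_)
  simp [inner_self_eq_norm_sq_to_K]

/-- Cauchy–Schwarz for a restricted function: only the part of `g` on `S` contributes. -/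
theorem norm_inner_indicator_sq_le {S : Set α} {f h : Lp ℂ 2 μ} (hS : NullMeasurableSet S μ)
    (hh : h =ᵐ[μ] S.indicator f) (g : Lp ℂ 2 μ) :
    ‖inner ℂ h g‖ ^ 2 ≤ ‖h‖ ^ 2 * ∫ x in S, ‖g x‖ ^ 2 ∂μ := by
  obtain ⟨k, hk⟩ := exists_indicator hS g
  have : inner ℂ h g = inner ℂ h k := by
    rw [L2.inner_def, L2.inner_def]
    refine integral_congr_ae ?_
    filter_upwards [hh, hk] with x hx hx'
    rw [hx, hx']
    by_cases h : x ∈ S <;> simp [h]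
  rw [this, ← norm_sq_indicator hS hk, ← mul_pow]
  gcongr
  exact norm_inner_le_norm h k

end L2

/-! ### The finite Fourier transform on `[-1,1]` -/

/-- The Fourier integral of a function on `[-1,1]`, as an entire function. -/
def finiteFourier (f : L2I) (z : ℂ) : ℂ :=
  ∫ u in Icc (-1 : ℝ) 1, Complex.exp (-(Complex.I * z * u)) * f u

/-- The part of the energy of `f` in the frequency band `[-c, c]`. -/
def concentration (c : ℝ) (f : L2I) : ℝ :=
  (2 * Real.pi)⁻¹ * ∫ t in Icc (-c) c, ‖finiteFourier f t‖ ^ 2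

theorem integrable_of_unitInterval (f : L2I) :
    Integrable f (volume.restrict (Icc (-1 : ℝ) 1)) :=
  (Lp.memLp f).integrable (by norm_num)

theorem differentiable_finiteFourier (f : L2I) : Differentiable ℂ (finiteFourier f) := by
  intro z
  have hf := integrable_of_unitInterval f
  have hm : ∀ w : ℂ, AEStronglyMeasurable (fun u : ℝ => Complex.exp (-(Complex.I * w * u)) * f u)
      (volume.restrict (Icc (-1 : ℝ) 1)) := fun w =>
    (Continuous.aestronglyMeasurable (by fun_prop)).mul hf.aestronglyMeasurable
  have hbound : ∀ w : ℂ, ∀ u ∈ Icc (-1 : ℝ) 1,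
      ‖Complex.exp (-(Complex.I * w * u))‖ ≤ Real.exp ‖w‖ := by
    intro w u hu
    rw [Complex.norm_exp]
    refine Real.exp_le_exp.2 ((Complex.re_le_norm _).trans ?_)
    rw [norm_neg, norm_mul, norm_mul, Complex.norm_I, one_mul, Complex.norm_real]
    exact mul_le_of_le_one_right (norm_nonneg _) (abs_le.2 hu)
  refine (hasDerivAt_integral_of_dominated_loc_of_deriv_le
    (F' := fun w u => -(Complex.I * u) * (Complex.exp (-(Complex.I * w * u)) * f u))
    (bound := fun u => Real.exp (‖z‖ + 1) * ‖f u‖) (Metric.ball_mem_nhds z one_pos)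
    (.of_forall hm) ?_ ?_ ?_ (hf.norm.const_mul _) ?_).2.differentiableAt
  · refine (hf.norm.const_mul (Real.exp ‖z‖)).mono' (hm z) ?_
    filter_upwards [ae_restrict_mem measurableSet_Icc] with u hu
    rw [norm_mul]
    gcongr
    exact hbound z u hu
  · exact (Continuous.aestronglyMeasurable (by fun_prop)).mul (hm z)
  · filter_upwards [ae_restrict_mem measurableSet_Icc] with u hu w hw
    have hw' : ‖w‖ ≤ ‖z‖ + 1 := by
      have := norm_sub_norm_le w z
      have h2 := mem_ball_iff_norm.1 hw
      linarith
    have hu' : ‖-(Complex.I * u)‖ ≤ 1 := by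
      rw [norm_neg, norm_mul, Complex.norm_I, one_mul, Complex.norm_real]
      exact abs_le.2 hu
    rw [norm_mul, norm_mul]
    calc _ ≤ 1 * (Real.exp ‖w‖ * ‖f u‖) := by gcongr; exact hbound w u hu
      _ ≤ _ := by rw [one_mul]; gcongr
  · refine .of_forall fun u w _ => ?_
    have h1 : HasDerivAt (fun w : ℂ => -(Complex.I * w * u)) (-(Complex.I * u)) w := by
      simpa using (((hasDerivAt_id w).const_mul Complex.I).mul_const (u : ℂ)).fun_neg
    exact (h1.cexp.mul_const (f u)).congr_deriv (by ring)

theorem continuous_finiteFourier (f : L2I) : Continuous fun t : ℝ => finiteFourier f t :=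
  (differentiable_finiteFourier f).continuous.comp Complex.continuous_ofReal

/-- Evaluation at a real frequency is a bounded functional. This yields homogeneity, the uniform
bound and weak continuity of `finiteFourier` used below. -/
theorem exists_exponential (t : ℝ) : ∃ e : L2I, ‖e‖ ^ 2 = 2 ∧
    ∀ f : L2I, inner ℂ e f = finiteFourier f t := by
  have hm : MemLp (fun u : ℝ => Complex.exp (Complex.I * t * u)) 2
      (volume.restrict (Icc (-1 : ℝ) 1)) := by
    refine MemLp.of_bound (Continuous.aestronglyMeasurable (by fun_prop)) 1 (.of_forall fun u => ?_)
    rw [show Complex.I * t * u = ((t * u : ℝ) : ℂ) * Complex.I by push_cast; ring,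
      Complex.norm_exp_ofReal_mul_I]
  refine ⟨hm.toLp _, ?_, fun f => ?_⟩
  · rw [norm_sq_eq_integral]
    have : ∫ u in Icc (-1 : ℝ) 1, ‖hm.toLp _ u‖ ^ 2 = ∫ u in Icc (-1 : ℝ) 1, (1 : ℝ) := by
      refine integral_congr_ae ?_
      filter_upwards [hm.coeFn_toLp] with u hu
      rw [hu, show Complex.I * t * u = ((t * u : ℝ) : ℂ) * Complex.I by push_cast; ring,
        Complex.norm_exp_ofReal_mul_I, one_pow]
    rw [this]
    simp
    norm_num
  · rw [L2.inner_def, finiteFourier]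
    refine integral_congr_ae ?_
    filter_upwards [hm.coeFn_toLp] with u hu
    rw [hu, RCLike.inner_apply, mul_comm, ← Complex.exp_conj]
    simp

theorem norm_finiteFourier_sq_le (f : L2I) (t : ℝ) : ‖finiteFourier f t‖ ^ 2 ≤ 2 * ‖f‖ ^ 2 := by
  obtain ⟨e, he, hef⟩ := exists_exponential t
  rw [← hef, ← he, ← mul_pow]
  gcongr
  exact norm_inner_le_norm e f

/-! ### Rescaling an interval and a band to centred ones -/

theorem memLp_comp_affine {h : ℝ → ℂ} (hh : MemLp h 2 volume) (m : ℝ) {l : ℝ} (hl : l ≠ 0) :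
    MemLp (fun u => h (m + l * u)) 2 volume := by
  have h1 : MemLp (fun x => h (m + x)) 2 volume :=
    hh.comp_measurePreserving (measurePreserving_add_left volume m)
  have h2 : MemLp (fun x => h (m + x)) 2 (Measure.map (fun u : ℝ => l * u) volume) := by
    rw [Real.map_volume_mul_left hl]
    exact h1.smul_measure (by simp)
  exact h2.comp_of_map (measurable_const_mul l).aemeasurable

theorem integral_comp_affine {E : Type*} [NormedAddCommGroup E] [NormedSpace ℝ E] (G : ℝ → E)
    (m : ℝ) {l : ℝ} (hl : 0 < l) {a b : ℝ} (hab : a ≤ b) :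
    ∫ u in Icc a b, G (m + l * u) = l⁻¹ • ∫ x in Icc (m + l * a) (m + l * b), G x := by
  rw [integral_Icc_eq_integral_Ioc, integral_Icc_eq_integral_Ioc,
    ← intervalIntegral.integral_of_le hab,
    ← intervalIntegral.integral_of_le (by gcongr),
    intervalIntegral.integral_comp_add_mul G hl.ne' m]

theorem quasiMeasurePreserving_mul_left {a : ℝ} (ha : a ≠ 0) :
    Measure.QuasiMeasurePreserving (fun u : ℝ => a * u) volume volume :=
  ⟨by fun_prop, by rw [Real.map_volume_mul_left ha]; exact Measure.smul_absolutelyContinuous⟩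

theorem ae_comp_affine {p : ℝ → Prop} (hp : ∀ᵐ x, p x) (m : ℝ) {l : ℝ} (hl : l ≠ 0) :
    ∀ᵐ u : ℝ, p (m + l * u) := by
  have h1 : ∀ᵐ x : ℝ, p (m + x) :=
    (measurePreserving_add_left volume m).quasiMeasurePreserving.ae hp
  exact (quasiMeasurePreserving_mul_left hl).ae h1

/-- `f` is obtained from `h`, a function on `[m - l, m + l]`, by the unitary rescaling to `[-1, 1]`
followed by a modulation. -/
def IsPullback (m l κ : ℝ) (h : L2R) (f : L2I) : Prop :=
  f =ᵐ[volume.restrict (Icc (-1 : ℝ) 1)]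
    fun u => ((√l : ℝ) : ℂ) * (Complex.exp (-(Complex.I * κ * u)) * h (m + l * u))

theorem exists_isPullback (m : ℝ) {l : ℝ} (hl : 0 < l) (κ : ℝ) (h : L2R) :
    ∃ f : L2I, IsPullback m l κ h f := by
  have h1 := ((memLp_comp_affine (Lp.memLp h) m hl.ne').restrict (Icc (-1 : ℝ) 1))
  have h2 : MemLp (fun u : ℝ => Complex.exp (-(Complex.I * κ * u)) * h (m + l * u)) 2
      (volume.restrict (Icc (-1 : ℝ) 1)) := by
    refine h1.of_le ((Continuous.aestronglyMeasurable (by fun_prop)).mul h1.1)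
      (.of_forall fun u => ?_)
    rw [norm_mul, show -(Complex.I * κ * u) = ((-(κ * u) : ℝ) : ℂ) * Complex.I by push_cast; ring,
      Complex.norm_exp_ofReal_mul_I, one_mul]
  exact ⟨(h2.const_mul _).toLp _, MemLp.coeFn_toLp _⟩

section Pullback

variable {m l κ : ℝ} {h : L2R} {f : L2I}

theorem IsPullback.norm_eq (hl : 0 < l) (hf : IsPullback m l κ h f)
    (hh : ∀ᵐ x, x ∉ Icc (m - l) (m + l) → h x = 0) : ‖f‖ = ‖h‖ := by
  have : ‖f‖ ^ 2 = ‖h‖ ^ 2 := by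
    rw [norm_sq_eq_integral, norm_sq_eq_integral]
    have h1 : ∫ u in Icc (-1 : ℝ) 1, ‖f u‖ ^ 2 = ∫ u in Icc (-1 : ℝ) 1, l * ‖h (m + l * u)‖ ^ 2 := by
      refine integral_congr_ae ?_
      filter_upwards [hf] with u hu
      rw [hu, norm_mul, norm_mul,
        show -(Complex.I * κ * u) = ((-(κ * u) : ℝ) : ℂ) * Complex.I by push_cast; ring,
        Complex.norm_exp_ofReal_mul_I, one_mul, mul_pow, Complex.norm_real, Real.norm_eq_abs,
        sq_abs, Real.sq_sqrt hl.le]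
    rw [h1, integral_comp_affine (fun x => l * ‖h x‖ ^ 2) m hl (by norm_num), smul_eq_mul,
      integral_const_mul, inv_mul_cancel_left₀ hl.ne', mul_neg_one, mul_one, ← sub_eq_add_neg]
    refine setIntegral_eq_integral_of_ae_compl_eq_zero ?_
    filter_upwards [hh] with x hx hx'
    simp [hx hx']
  exact (sq_eq_sq₀ (norm_nonneg _) (norm_nonneg _)).1 this

theorem IsPullback.norm_fourier_sq (hl : 0 < l) (hf : IsPullback m l κ h f)
    (hh : ∀ᵐ x, x ∉ Icc (m - l) (m + l) → h x = 0) :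
    ∀ᵐ ξ : ℝ, ‖(𝓕 h : L2R) ξ‖ ^ 2 =
      l * ‖finiteFourier f ((-κ + 2 * Real.pi * l * ξ : ℝ) : ℂ)‖ ^ 2 := by
  have hint : Integrable h := by
    have h1 : Integrable h (volume.restrict (Icc (m - l) (m + l))) :=
      ((Lp.memLp h).restrict _).integrable (by norm_num)
    refine (integrable_indicator_iff measurableSet_Icc).2 h1 |>.congr ?_
    filter_upwards [hh] with x hx
    by_cases hx' : x ∈ Icc (m - l) (m + l) <;> simp [hx', hx]
  filter_upwards [fourier_ae_eq_of_integrable h hint] with ξ hξ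
  -- Translation by `m` costs only the constant phase `exp(2πiξm)`, and modulation by `κ` only
  -- shifts the frequency; neither survives in the modulus.
  let G : ℝ → ℂ := fun x => ((√l : ℝ) : ℂ) * Complex.exp (Complex.I *
    ((2 * Real.pi * ξ * m : ℝ) : ℂ)) *
    (Complex.exp (((-2 * Real.pi * x * ξ : ℝ) : ℂ) * Complex.I) • h x)
  have h1 : finiteFourier f ((-κ + 2 * Real.pi * l * ξ : ℝ) : ℂ) =
      ∫ u in Icc (-1 : ℝ) 1, G (m + l * u) := by
    refine integral_congr_ae ?_
    filter_upwards [hf] with u hu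
    simp only [hu, smul_eq_mul, G]
    have : Complex.exp (-(Complex.I * ((-κ + 2 * Real.pi * l * ξ : ℝ) : ℂ) * u)) *
        Complex.exp (-(Complex.I * κ * u)) = Complex.exp (Complex.I *
        ((2 * Real.pi * ξ * m : ℝ) : ℂ)) *
        Complex.exp (((-2 * Real.pi * (m + l * u) * ξ : ℝ) : ℂ) * Complex.I) := by
      rw [← Complex.exp_add, ← Complex.exp_add]
      congr 1
      push_cast
      ring
    linear_combination ((√l : ℝ) : ℂ) * h (m + l * u) * this
  have h2 : ∫ x in Icc (m + l * -1) (m + l * 1),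
      Complex.exp (((-2 * Real.pi * x * ξ : ℝ) : ℂ) * Complex.I) • h x = 𝓕 (h : ℝ → ℂ) ξ := by
    rw [Real.fourier_real_eq_integral_exp_smul, mul_neg_one, mul_one, ← sub_eq_add_neg]
    refine setIntegral_eq_integral_of_ae_compl_eq_zero ?_
    filter_upwards [hh] with x hx hx'
    simp [hx hx']
  rw [h1, integral_comp_affine G m hl (by norm_num), integral_const_mul, h2, hξ, norm_smul,
    norm_mul, norm_mul, mul_comm Complex.I, Complex.norm_exp_ofReal_mul_I, Complex.norm_real,
    Real.norm_eq_abs, Real.norm_eq_abs, mul_pow, mul_pow, mul_pow, sq_abs, sq_abs,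
    Real.sq_sqrt hl.le]
  field_simp

/-- The energy of `h` in a frequency band is that of its pullback in a centred band. -/
theorem IsPullback.setIntegral_fourier (hl : 0 < l) {ξ₁ ξ₂ : ℝ} (hξ : ξ₁ ≤ ξ₂)
    (hf : IsPullback m l (Real.pi * l * (ξ₁ + ξ₂)) h f)
    (hh : ∀ᵐ x, x ∉ Icc (m - l) (m + l) → h x = 0) :
    ∫ ξ in Icc ξ₁ ξ₂, ‖(𝓕 h : L2R) ξ‖ ^ 2 = concentration (Real.pi * l * (ξ₂ - ξ₁)) f := by
  have hpi := Real.pi_pos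
  -- The value of `κ` is chosen so that `ξ ↦ -κ + 2πlξ` carries `[ξ₁, ξ₂]` onto the symmetric
  -- interval of half-length `πl(ξ₂ - ξ₁)`.
  rw [integral_congr_ae (ae_restrict_of_ae (hf.norm_fourier_sq hl hh)),
    integral_comp_affine (fun t : ℝ => l * ‖finiteFourier f (t : ℂ)‖ ^ 2) _
    (by positivity : 0 < 2 * Real.pi * l) hξ, integral_const_mul, concentration, smul_eq_mul,
    ← mul_assoc]
  congr 1
  · field_simp
  · congr 3 <;> ring

end Pullback

/-! ### Energy in a band as a function of the bandwidth -/

theorem exists_zeroExtension (f : L2I) :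
    ∃ h : L2R, h =ᵐ[volume] (Icc (-1 : ℝ) 1).indicator f := by
  have hm := (memLp_indicator_iff_restrict measurableSet_Icc).2 (Lp.memLp f)
  exact ⟨hm.toLp _, hm.coeFn_toLp⟩

/-- Plancherel on the line for the extension by zero; `2π` is the change of frequency unit. -/
theorem integral_norm_finiteFourier_sq (f : L2I) :
    Integrable (fun t : ℝ => ‖finiteFourier f t‖ ^ 2) ∧
      ∫ t : ℝ, ‖finiteFourier f t‖ ^ 2 = 2 * Real.pi * ‖f‖ ^ 2 := by
  obtain ⟨h, hh⟩ := exists_zeroExtension f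
  have hsupp : ∀ᵐ x, x ∉ Icc (0 - 1 : ℝ) (0 + 1) → h x = 0 := by
    filter_upwards [hh] with x hx hx'
    rw [hx, indicator_of_notMem (by simpa using hx')]
  have hp : IsPullback 0 1 0 h f := by
    filter_upwards [ae_restrict_of_ae hh, ae_restrict_mem measurableSet_Icc] with u hu hu'
    simp [hu, indicator_of_mem hu']
  have hF := hp.norm_fourier_sq one_pos hsupp
  simp only [neg_zero, zero_add, mul_one, one_mul] at hF
  have hpi := Real.pi_pos
  have hint := (integrable_norm_sq (𝓕 h : L2R)).congr hF
  have hne : 2 * Real.pi ≠ 0 := by positivity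
  refine ⟨(integrable_comp_mul_left_iff (fun t : ℝ => ‖finiteFourier f t‖ ^ 2) hne).1 hint, ?_⟩
  have h1 := integral_congr_ae hF
  rw [← norm_sq_eq_integral, Lp.norm_fourier_eq, ← hp.norm_eq one_pos hsupp,
    Measure.integral_comp_mul_left (fun t : ℝ => ‖finiteFourier f t‖ ^ 2), smul_eq_mul,
    abs_of_pos (by positivity)] at h1
  rw [h1]
  field_simp

theorem finiteFourier_eq_zero_iff {f : L2I} : (∀ t : ℝ, finiteFourier f t = 0) ↔ f = 0 := by
  constructor
  · intro h
    have h1 := (integral_norm_finiteFourier_sq f).2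
    simpa [h, Real.pi_ne_zero] using h1.symm
  · rintro rfl t
    obtain ⟨e, -, he⟩ := exists_exponential t
    rw [← he, inner_zero_right]

theorem finiteFourier_smul (a : ℂ) (f : L2I) (t : ℝ) :
    finiteFourier (a • f) t = a * finiteFourier f t := by
  obtain ⟨e, -, he⟩ := exists_exponential t
  rw [← he, ← he, inner_smul_right]

theorem concentration_smul (c : ℝ) (a : ℂ) (f : L2I) :
    concentration c (a • f) = ‖a‖ ^ 2 * concentration c f := by
  simp only [concentration, finiteFourier_smul, norm_mul, mul_pow]
  rw [integral_const_mul]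
  ring

theorem concentration_nonneg (c : ℝ) (f : L2I) : 0 ≤ concentration c f := by
  have := Real.pi_pos
  exact mul_nonneg (by positivity) (integral_nonneg fun _ => by positivity)

theorem concentration_le (c : ℝ) (f : L2I) : concentration c f ≤ ‖f‖ ^ 2 := by
  have hpi := Real.pi_pos
  obtain ⟨h1, h2⟩ := integral_norm_finiteFourier_sq f
  have h3 := setIntegral_le_integral (s := Icc (-c) c) h1 (.of_forall fun _ => by positivity)
  rw [h2] at h3
  rw [concentration, inv_mul_le_iff₀ (by positivity)]
  exact h3

theorem concentration_eq_intervalIntegral {c : ℝ} (hc : 0 ≤ c) (f : L2I) :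
    concentration c f = (2 * Real.pi)⁻¹ * ∫ t in (-c)..c, ‖finiteFourier f t‖ ^ 2 := by
  rw [concentration, intervalIntegral.integral_of_le (by linarith), integral_Icc_eq_integral_Ioc]

theorem concentration_zero (f : L2I) : concentration 0 f = 0 := by
  rw [concentration_eq_intervalIntegral le_rfl]
  simp

theorem tendsto_concentration (f : L2I) :
    Tendsto (fun c => concentration c f) atTop (𝓝 (‖f‖ ^ 2)) := by
  have hpi := Real.pi_pos
  obtain ⟨h1, h2⟩ := integral_norm_finiteFourier_sq f
  have h3 := (intervalIntegral_tendsto_integral h1 tendsto_neg_atTop_atBot tendsto_id).const_mul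
    ((2 * Real.pi)⁻¹)
  rw [h2, inv_mul_cancel_left₀ (by positivity)] at h3
  refine h3.congr' ?_
  filter_upwards [eventually_ge_atTop 0] with c hc
  rw [concentration_eq_intervalIntegral hc, id]

theorem concentration_sub {c c' : ℝ} (hc : 0 ≤ c) (hcc' : c ≤ c') (f : L2I) :
    concentration c' f - concentration c f = (2 * Real.pi)⁻¹ *
      ((∫ t in (-c')..(-c), ‖finiteFourier f t‖ ^ 2) + ∫ t in c..c', ‖finiteFourier f t‖ ^ 2) := by
  have hcont : Continuous fun t : ℝ => ‖finiteFourier f t‖ ^ 2 :=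
    (continuous_finiteFourier f).norm.pow 2
  rw [concentration_eq_intervalIntegral hc, concentration_eq_intervalIntegral (hc.trans hcc'),
    ← intervalIntegral.integral_add_adjacent_intervals (hcont.intervalIntegrable (-c') (-c))
      (hcont.intervalIntegrable (-c) c'),
    ← intervalIntegral.integral_add_adjacent_intervals (hcont.intervalIntegrable (-c) c)
      (hcont.intervalIntegrable c c')]
  ring

/-- The added band has length `2(c' - c)` and density at most `2‖f‖²/(2π)`, giving the constant `2/π
≤ 1`. This makes `lambda0` Lipschitz. -/
theorem concentration_sub_le {c c' : ℝ} (hc : 0 ≤ c) (hcc' : c ≤ c') (f : L2I) :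
    concentration c' f - concentration c f ≤ ‖f‖ ^ 2 * (c' - c) := by
  have hcont : Continuous fun t : ℝ => ‖finiteFourier f t‖ ^ 2 :=
    (continuous_finiteFourier f).norm.pow 2
  have hle : ∀ a b : ℝ, a ≤ b →
      ∫ t in a..b, ‖finiteFourier f t‖ ^ 2 ≤ 2 * ‖f‖ ^ 2 * (b - a) := by
    intro a b hab
    have := intervalIntegral.integral_mono_on hab (hcont.intervalIntegrable a b)
      (continuous_const.intervalIntegrable (μ := volume) a b) fun t _ => norm_finiteFourier_sq_le f t
    exact this.trans_eq (by rw [intervalIntegral.integral_const, smul_eq_mul, mul_comm])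
  have h1 := hle (-c') (-c) (by linarith)
  have h2 := hle c c' hcc'
  have hpi := Real.pi_gt_three
  rw [concentration_sub hc hcc', inv_mul_le_iff₀ (by positivity)]
  have h3 : 0 ≤ ‖f‖ ^ 2 * (c' - c) := mul_nonneg (by positivity) (by linarith)
  nlinarith

/-- By analyticity, the Fourier transform of a function on `[-1, 1]` does not vanish on an
interval. -/
theorem exists_finiteFourier_ne_zero {a b : ℝ} (hab : a < b) {f : L2I} (hf : f ≠ 0) :
    ∃ t ∈ Icc a b, finiteFourier f t ≠ 0 := by
  by_contra! h
  refine hf (finiteFourier_eq_zero_iff.1 fun t => ?_)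
  have han : AnalyticOnNhd ℂ (finiteFourier f) univ :=
    (differentiable_finiteFourier f).differentiableOn.analyticOnNhd isOpen_univ
  refine han.eqOn_zero_of_preconnected_of_frequently_eq_zero isPreconnected_univ
    (mem_univ (((a + b) / 2 : ℝ) : ℂ)) ?_ (mem_univ _)
  have htend : Tendsto (fun t : ℝ => (t : ℂ)) (𝓝[≠] ((a + b) / 2)) (𝓝[≠] (((a + b) / 2 : ℝ) : ℂ)) :=
    Complex.continuous_ofReal.continuousAt.continuousWithinAt.tendsto_nhdsWithin
      fun x hx => by simpa [← Complex.ofReal_inj] using hx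
  refine htend.frequently (Eventually.frequently ?_)
  filter_upwards [nhdsWithin_le_nhds (Icc_mem_nhds (by linarith : a < (a + b) / 2)
    (by linarith : (a + b) / 2 < b))] with t ht
  exact h t ht

theorem concentration_strictMono {c c' : ℝ} (hc : 0 ≤ c) (hcc' : c < c') {f : L2I} (hf : f ≠ 0) :
    concentration c f < concentration c' f := by
  have hpi := Real.pi_pos
  rw [← sub_pos, concentration_sub hc hcc'.le]
  obtain ⟨t, ht, ht'⟩ := exists_finiteFourier_ne_zero hcc' hf
  refine mul_pos (by positivity) (add_pos_of_nonneg_of_pos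
    (intervalIntegral.integral_nonneg (by linarith) fun _ _ => by positivity)
    (intervalIntegral.integral_pos hcc' ((continuous_finiteFourier f).norm.pow 2).continuousOn
      (fun _ _ => by positivity) ⟨t, ht, by positivity⟩))

theorem exists_norm_eq_one : ∃ f : L2I, ‖f‖ = 1 := by
  obtain ⟨e, he, -⟩ := exists_exponential 0
  have hne : ‖e‖ ≠ 0 := by
    intro h
    norm_num [h] at he
  exact ⟨((‖e‖⁻¹ : ℝ) : ℂ) • e, by
    rw [norm_smul, Complex.norm_real, norm_inv, norm_norm, inv_mul_cancel₀ hne]⟩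

/-! ### Existence of a maximizer -/

/-- The concentration functional is weakly sequentially continuous on bounded sets, so that it
attains its maximum on the unit sphere. -/
theorem exists_concentration_max {c : ℝ} (hc : 0 < c) :
    ∃ f : L2I, ‖f‖ = 1 ∧ ∀ g : L2I, concentration c g ≤ concentration c f * ‖g‖ ^ 2 := by
  have : Fact ((2 : ℝ≥0∞) ≠ ⊤) := ⟨by simp⟩
  have : TopologicalSpace.SeparableSpace L2I :=
    TopologicalSpace.SecondCountableTopology.to_separableSpace
  let S : Set ℝ := concentration c '' Metric.closedBall 0 1
  have hbdd : BddAbove S := by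
    refine ⟨1, ?_⟩
    rintro _ ⟨f, hf, rfl⟩
    rw [mem_closedBall_zero_iff] at hf
    exact (concentration_le c f).trans (pow_le_one₀ (norm_nonneg _) hf)
  obtain ⟨s, -, hs, hsS⟩ := exists_seq_tendsto_sSup (S := S)
    ⟨_, 0, by simp, rfl⟩ hbdd
  choose F hF hFs using hsS
  let φ : ℕ → WeakDual ℂ L2I := fun n =>
    StrongDual.toWeakDual (InnerProductSpace.toDual ℂ L2I (F n))
  -- Sequential Banach–Alaoglu, available because `L2I` is separable; Riesz representation turns the
  -- limit functional back into a vector.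
  obtain ⟨ψ, hψ, σ, hσ, hlim⟩ := WeakDual.isSeqCompact_closedBall ℂ L2I 0 1 (x := φ) (fun n => by
    have h1 := hF n
    rw [mem_closedBall_zero_iff] at h1
    change InnerProductSpace.toDual ℂ L2I (F n) ∈ Metric.closedBall 0 1
    rw [mem_closedBall_zero_iff, LinearIsometryEquiv.norm_map]
    exact h1)
  let f : L2I := (InnerProductSpace.toDual ℂ L2I).symm (WeakDual.toStrongDual ψ)
  have hfnorm : ‖f‖ ≤ 1 := by
    have : WeakDual.toStrongDual ψ ∈ Metric.closedBall 0 1 := hψ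
    rw [mem_closedBall_zero_iff] at this
    rw [LinearIsometryEquiv.norm_map]
    exact this
  have hweak : ∀ t : ℝ, Tendsto (fun n => finiteFourier (F (σ n)) t) atTop
      (𝓝 (finiteFourier f t)) := by
    intro t
    obtain ⟨e, -, he⟩ := exists_exponential t
    have h1 : Tendsto (fun n => φ (σ n) e) atTop (𝓝 (ψ e)) :=
      ((WeakDual.eval_continuous e).tendsto ψ).comp hlim
    have h2 : ψ e = inner ℂ f e := by
      rw [InnerProductSpace.toDual_symm_apply]
      rfl
    rw [h2] at h1
    have h3 := (Complex.continuous_conj.tendsto _).comp h1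
    rw [inner_conj_symm, he] at h3
    refine h3.congr fun n => ?_
    rw [← he, ← inner_conj_symm]
    rfl
  have hconc : Tendsto (fun n => concentration c (F (σ n))) atTop (𝓝 (concentration c f)) := by
    refine Tendsto.const_mul _ (tendsto_integral_of_dominated_convergence (fun _ => (2 : ℝ))
      (fun n => ((continuous_finiteFourier _).norm.pow 2).aestronglyMeasurable) (by simp)
      (fun n => .of_forall fun t => ?_) (.of_forall fun t => ((hweak t).norm.pow 2)))
    have h1 := hF (σ n)
    rw [mem_closedBall_zero_iff] at h1
    rw [norm_pow, norm_norm]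
    refine (norm_finiteFourier_sq_le _ t).trans ?_
    nlinarith [pow_le_one₀ (norm_nonneg _) h1 (n := 2)]
  have hmax : concentration c f = sSup S := by
    refine tendsto_nhds_unique hconc ?_
    simp only [hFs]
    exact hs.comp hσ.tendsto_atTop
  have hle : ∀ g : L2I, concentration c g ≤ concentration c f * ‖g‖ ^ 2 := by
    intro g
    by_cases hg : g = 0
    · subst hg
      simpa using concentration_le c 0
    have hg' : ‖g‖ ≠ 0 := norm_ne_zero_iff.2 hg
    have h1 : concentration c (((‖g‖⁻¹ : ℝ) : ℂ) • g) ≤ concentration c f := by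
      rw [hmax]
      refine le_csSup hbdd ⟨_, ?_, rfl⟩
      rw [mem_closedBall_zero_iff, norm_smul, Complex.norm_real, norm_inv, norm_norm,
        inv_mul_cancel₀ hg']
    rw [concentration_smul, Complex.norm_real, norm_inv, norm_norm, inv_pow,
      inv_mul_le_iff₀ (by positivity)] at h1
    linarith
  refine ⟨f, le_antisymm hfnorm ?_, hle⟩
  obtain ⟨g, hg⟩ := exists_norm_eq_one
  -- The weak limit could have lost norm. Since the maximum is positive and the form is homogeneous
  -- of degree two, `hle f` forces `1 ≤ ‖f‖²`.
  have hpos : 0 < concentration c f := by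
    have h1 := concentration_strictMono le_rfl hc (norm_ne_zero_iff.1 (hg ▸ one_ne_zero))
    have h2 := hle g
    rw [concentration_zero] at h1
    rw [hg] at h2
    linarith
  have h3 := hle f
  have h4 : 1 ≤ ‖f‖ ^ 2 := by
    by_contra! h
    nlinarith
  exact (one_le_sq_iff₀ (norm_nonneg _)).1 h4

/-! ### The operator `K_c` and its quadratic form -/

theorem sincKernel_eq_integral {c : ℝ} (hc : 0 ≤ c) (u v : ℝ) : (sincKernel c u v : ℂ) =
    (2 * Real.pi : ℂ)⁻¹ * ∫ t in Icc (-c) c,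
      Complex.exp (-(Complex.I * t * v)) * Complex.exp (Complex.I * t * u) := by
  have hpi : (Real.pi : ℂ) ≠ 0 := by exact_mod_cast Real.pi_ne_zero
  rw [integral_Icc_eq_integral_Ioc, ← intervalIntegral.integral_of_le (by linarith)]
  have h1 : ∀ t : ℝ, Complex.exp (-(Complex.I * t * v)) * Complex.exp (Complex.I * t * u) =
      Complex.exp ((Complex.I * (u - v)) * t) := by
    intro t
    rw [← Complex.exp_add]
    congr 1
    ring
  simp only [h1]
  by_cases huv : u = v
  · subst huv
    simp [sincKernel]
    field_simp
    norm_num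
  · have huv' : (u : ℂ) - v ≠ 0 := by
      rw [sub_ne_zero]
      exact_mod_cast huv
    rw [integral_exp_mul_complex (mul_ne_zero Complex.I_ne_zero huv')]
    by_cases hc0 : c = 0
    · simp [hc0, sincKernel]
    have hne : c * (u - v) ≠ 0 := mul_ne_zero hc0 (sub_ne_zero.2 huv)
    rw [sincKernel, Real.sinc_of_ne_zero hne]
    push_cast
    rw [Complex.sin]
    have hc0' : (c : ℂ) ≠ 0 := by exact_mod_cast hc0
    have h2 : Complex.I * (u - v) * (-c) = -(c * (u - v)) * Complex.I := by ring
    have h3 : Complex.I * (u - v) * c = (c * (u - v)) * Complex.I := by ring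
    rw [h2, h3]
    field_simp
    ring_nf
    simp only [Complex.I_sq]
    ring

/-- Fubini for the pairing of `e^{-itu}` with an integrable function of `u ∈ [-1, 1]` and a
continuous function of `t ∈ [-c, c]`. -/
theorem integral_exp_swap (c : ℝ) (f : L2I) {G : ℝ → ℂ} (hG : Continuous G) :
    ∫ u in Icc (-1 : ℝ) 1, (∫ t in Icc (-c) c, Complex.exp (-(Complex.I * t * u)) * G t) * f u =
      ∫ t in Icc (-c) c, G t * finiteFourier f t := by
  simp only [← integral_mul_const]
  rw [integral_integral_swap]
  · refine integral_congr_ae (.of_forall fun t => ?_)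
    simp only [finiteFourier, ← integral_const_mul]
    refine integral_congr_ae (.of_forall fun u => ?_)
    simp only
    ring
  · have h1 : Integrable G (volume.restrict (Icc (-c) c)) :=
      hG.continuousOn.integrableOn_compact isCompact_Icc
    have h2 := (integrable_of_unitInterval f).mul_prod h1
    refine (h2.bdd_mul (c := 1) (f := fun p : ℝ × ℝ => Complex.exp (-(Complex.I * p.2 * p.1)))
      (Continuous.aestronglyMeasurable (by fun_prop)) (.of_forall fun p => ?_)).congr
      (.of_forall fun p => ?_)
    · rw [show -(Complex.I * p.2 * p.1) = ((-(p.2 * p.1) : ℝ) : ℂ) * Complex.I by push_cast; ring,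
        Complex.norm_exp_ofReal_mul_I]
    · simp only [Function.uncurry]
      ring

theorem integral_sincKernel {c : ℝ} (hc : 0 ≤ c) (f : L2I) (u : ℝ) :
    ∫ v in Icc (-1 : ℝ) 1, (sincKernel c u v : ℂ) * f v =
      (2 * Real.pi : ℂ)⁻¹ * ∫ t in Icc (-c) c, Complex.exp (Complex.I * t * u) *
        finiteFourier f t := by
  rw [← integral_exp_swap c f (by fun_prop), ← integral_const_mul]
  refine integral_congr_ae (.of_forall fun v => ?_)
  simp only [sincKernel_eq_integral hc, mul_assoc]

/-- The sesquilinear form whose diagonal is `concentration c`. -/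
def concentrationForm (c : ℝ) (f g : L2I) : ℂ :=
  (2 * Real.pi : ℂ)⁻¹ * ∫ t in Icc (-c) c, conj (finiteFourier f t) * finiteFourier g t

theorem concentrationForm_self (c : ℝ) (f : L2I) :
    concentrationForm c f f = (concentration c f : ℂ) := by
  simp only [concentrationForm, concentration, ← Complex.normSq_eq_conj_mul_self,
    Complex.normSq_eq_norm_sq]
  rw [integral_complex_ofReal]
  push_cast
  rfl

/-- Cauchy–Schwarz in L² of the band `[-c, c]`. -/
theorem norm_concentrationForm_sq_le (c : ℝ) (f g : L2I) :
    ‖concentrationForm c f g‖ ^ 2 ≤ concentration c f * concentration c g := by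
  have hmem : ∀ f : L2I,
      MemLp (fun t : ℝ => finiteFourier f t) 2 (volume.restrict (Icc (-c) c)) := fun f =>
    MemLp.of_bound (continuous_finiteFourier f).aestronglyMeasurable (√(2 * ‖f‖ ^ 2))
      (.of_forall fun t => Real.le_sqrt_of_sq_le (norm_finiteFourier_sq_le f t))
  have hnorm : ∀ f : L2I, ∫ t in Icc (-c) c, ‖finiteFourier f t‖ ^ 2 =
      ‖(hmem f).toLp _‖ ^ 2 := fun f => by
    rw [norm_sq_eq_integral]
    refine integral_congr_ae ?_
    filter_upwards [(hmem f).coeFn_toLp] with t ht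
    rw [ht]
  have hinner : ∫ t in Icc (-c) c, conj (finiteFourier f t) * finiteFourier g t =
      inner ℂ ((hmem f).toLp _) ((hmem g).toLp _) := by
    rw [L2.inner_def]
    refine integral_congr_ae ?_
    filter_upwards [(hmem f).coeFn_toLp, (hmem g).coeFn_toLp] with t ht ht'
    rw [ht, ht', RCLike.inner_apply, mul_comm]
  have hpi := Real.pi_pos
  rw [concentrationForm, concentration, concentration, hnorm, hnorm, hinner, norm_mul, mul_pow]
  have h1 : ‖(2 * Real.pi : ℂ)⁻¹‖ = (2 * Real.pi)⁻¹ := by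
    rw [norm_inv, norm_mul, Complex.norm_real, Real.norm_of_nonneg hpi.le, Complex.norm_ofNat]
  rw [h1]
  have h2 := pow_le_pow_left₀ (norm_nonneg _)
    (norm_inner_le_norm (𝕜 := ℂ) ((hmem f).toLp _) ((hmem g).toLp _)) 2
  calc _ ≤ (2 * Real.pi)⁻¹ ^ 2 * (‖(hmem f).toLp _‖ * ‖(hmem g).toLp _‖) ^ 2 := by gcongr
    _ = _ := by ring

/-- If `r` represents `K_c f`, then `⟨r, g⟩` is given by the concentration form. -/
theorem inner_eq_concentrationForm {c : ℝ} (hc : 0 ≤ c) {f r : L2I}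
    (hr : ∀ᵐ u ∂(volume.restrict (Icc (-1 : ℝ) 1)),
      ∫ v in Icc (-1 : ℝ) 1, (sincKernel c u v : ℂ) * f v = r u) (g : L2I) :
    inner ℂ r g = concentrationForm c f g := by
  have hcont := continuous_finiteFourier f
  rw [L2.inner_def, concentrationForm,
    ← integral_exp_swap c g (G := fun t => conj (finiteFourier f t))
      (Complex.continuous_conj.comp hcont), ← integral_const_mul]
  refine integral_congr_ae ?_
  filter_upwards [hr] with u hu
  rw [← hu, integral_sincKernel hc, RCLike.inner_apply, map_mul, ← integral_conj, mul_comm,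
    mul_assoc]
  congr 1
  · rw [← Complex.ofReal_ofNat, ← Complex.ofReal_mul, ← Complex.ofReal_inv, Complex.conj_ofReal]
  · congr 1
    refine integral_congr_ae (.of_forall fun t => ?_)
    simp [← Complex.exp_conj]

/-- The image of `f` under `K_c` is a continuous function, hence bounded on `[-1,1]` and in L². -/
theorem exists_slepian (c : ℝ) (hc : 0 ≤ c) (f : L2I) :
    ∃ r : L2I, ∀ᵐ u ∂(volume.restrict (Icc (-1 : ℝ) 1)),
      ∫ v in Icc (-1 : ℝ) 1, (sincKernel c u v : ℂ) * f v = r u := by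
  have hcont := continuous_finiteFourier f
  have hm : MemLp (fun u : ℝ => ∫ v in Icc (-1 : ℝ) 1, (sincKernel c u v : ℂ) * f v) 2
      (volume.restrict (Icc (-1 : ℝ) 1)) := by
    simp only [integral_sincKernel hc]
    have hK : Continuous fun u : ℝ => (2 * Real.pi : ℂ)⁻¹ * ∫ t in Icc (-c) c,
        Complex.exp (Complex.I * t * u) * finiteFourier f t := by
      refine continuous_const.mul (continuous_of_dominated
        (bound := fun _ => √(2 * ‖f‖ ^ 2)) (fun u => Continuous.aestronglyMeasurable (by fun_prop))
        (fun u => .of_forall fun t => ?_) (integrable_const _) (.of_forall fun t => by fun_prop))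
      rw [norm_mul, show Complex.I * t * u = ((t * u : ℝ) : ℂ) * Complex.I by push_cast; ring,
        Complex.norm_exp_ofReal_mul_I, one_mul]
      exact Real.le_sqrt_of_sq_le (norm_finiteFourier_sq_le f t)
    obtain ⟨B, hB⟩ := isCompact_Icc.exists_bound_of_continuousOn
      (hK.continuousOn (s := Icc (-1 : ℝ) 1))
    exact MemLp.of_bound hK.aestronglyMeasurable B
      ((ae_restrict_mem measurableSet_Icc).mono hB)
  exact ⟨hm.toLp _, hm.coeFn_toLp.mono fun u hu => hu.symm⟩

/-- Pairing the eigenvalue equation with `f` shows that an eigenvalue is a Rayleigh quotient, so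
none exceeds the maximum. -/
theorem IsSlepianEigenfunction.concentration_eq {c lam : ℝ} (hc : 0 ≤ c) {f : L2I}
    (hf : IsSlepianEigenfunction c lam f) : concentration c f = lam * ‖f‖ ^ 2 := by
  have h1 := inner_eq_concentrationForm hc (f := f) (r := (lam : ℂ) • f) (by
    filter_upwards [hf.2, Lp.coeFn_smul (lam : ℂ) f] with u hu hu'
    rw [hu, hu', Pi.smul_apply, smul_eq_mul]) f
  rw [inner_smul_left, inner_self_eq_norm_sq_to_K, concentrationForm_self, Complex.conj_ofReal] at h1
  have h2 : ((lam * ‖f‖ ^ 2 : ℝ) : ℂ) = (concentration c f : ℂ) := by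
    rw [← h1]
    push_cast
    rfl
  exact (Complex.ofReal_inj.1 h2).symm

/-- With `r = K_c f` and `λ` the maximum, Cauchy–Schwarz for the form gives `‖r‖⁴ ≤ λ · λ‖r‖²`, so
`‖r‖ ≤ λ`. Since `⟨r, f⟩ = λ`, expanding gives `‖r - λf‖² ≤ λ² - 2λ² + λ² = 0`. -/
theorem isSlepianEigenfunction_of_max {c : ℝ} (hc : 0 ≤ c) {f : L2I} (hf : ‖f‖ = 1)
    (hmax : ∀ g : L2I, concentration c g ≤ concentration c f * ‖g‖ ^ 2) :
    IsSlepianEigenfunction c (concentration c f) f := by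
  obtain ⟨r, hr⟩ := exists_slepian c hc f
  have hrf : inner ℂ r f = (concentration c f : ℂ) := by
    rw [inner_eq_concentrationForm hc hr, concentrationForm_self]
  have hrr : (‖r‖ ^ 2) ^ 2 ≤ concentration c f * (concentration c f * ‖r‖ ^ 2) := by
    have h1 := norm_concentrationForm_sq_le c f r
    rw [← inner_eq_concentrationForm hc hr, inner_self_eq_norm_sq_to_K, norm_pow,
      RCLike.norm_ofReal, abs_norm] at h1
    exact h1.trans (mul_le_mul_of_nonneg_left (hmax r) (concentration_nonneg c f))
  have hr_le : ‖r‖ ^ 2 ≤ concentration c f ^ 2 := by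
    by_contra! h
    have := sq_nonneg (concentration c f)
    nlinarith
  have hre : r = (concentration c f : ℂ) • f := by
    rw [← sub_eq_zero, ← norm_eq_zero, ← sq_eq_zero_iff (a := ‖_‖)]
    refine le_antisymm ?_ (by positivity)
    rw [@norm_sub_sq ℂ, inner_smul_right, hrf, norm_smul, hf, Complex.norm_real, mul_one,
      Real.norm_eq_abs, sq_abs, ← Complex.ofReal_mul]
    simp only [RCLike.re_to_complex, Complex.ofReal_re]
    nlinarith
  refine ⟨norm_ne_zero_iff.1 (by rw [hf]; exact one_ne_zero), ?_⟩
  filter_upwards [hr, Lp.coeFn_smul (concentration c f : ℂ) f] with u hu hu'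
  rw [hu, hre, hu', Pi.smul_apply, smul_eq_mul]

/-! ### Variational description and properties of `λ₀` -/

theorem exists_concentration_eq_lambda0 {c : ℝ} (hc : 0 ≤ c) :
    IsGreatest (slepianEigenvalues c) (lambda0 c) ∧
      (∃ f : L2I, ‖f‖ = 1 ∧ concentration c f = lambda0 c) ∧
      ∀ g : L2I, concentration c g ≤ lambda0 c * ‖g‖ ^ 2 := by
  obtain ⟨f, hf, hmax⟩ : ∃ f : L2I, ‖f‖ = 1 ∧
      ∀ g : L2I, concentration c g ≤ concentration c f * ‖g‖ ^ 2 := by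
    -- At `c = 0` the form vanishes and every unit vector is a maximizer.
    rcases hc.eq_or_lt with rfl | hc
    · obtain ⟨f, hf⟩ := exists_norm_eq_one
      exact ⟨f, hf, fun g => by simp [concentration_zero]⟩
    · exact exists_concentration_max hc
  have hgr : IsGreatest (slepianEigenvalues c) (concentration c f) := by
    refine ⟨⟨f, isSlepianEigenfunction_of_max hc hf hmax⟩, ?_⟩
    rintro lam ⟨g, hg⟩
    have h1 := hmax g
    rw [hg.concentration_eq hc] at h1
    exact le_of_mul_le_mul_right h1 (by have := norm_pos_iff.2 hg.1; positivity)
  have heq : lambda0 c = concentration c f := hgr.csSup_eq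
  rw [heq]
  exact ⟨hgr, ⟨f, hf, rfl⟩, hmax⟩

theorem isGreatest_lambda0 {c : ℝ} (hc : 0 ≤ c) : IsGreatest (slepianEigenvalues c) (lambda0 c) :=
  (exists_concentration_eq_lambda0 hc).1

theorem concentration_le_lambda0 {c : ℝ} (hc : 0 ≤ c) (f : L2I) :
    concentration c f ≤ lambda0 c * ‖f‖ ^ 2 :=
  (exists_concentration_eq_lambda0 hc).2.2 f

theorem lambda0_strictMonoOn : StrictMonoOn lambda0 (Ici 0) := by
  intro c hc c' hc' hcc'
  obtain ⟨f, hf, hfc⟩ := (exists_concentration_eq_lambda0 hc).2.1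
  have h1 := concentration_strictMono hc hcc' (norm_ne_zero_iff.1 (hf ▸ one_ne_zero))
  have h2 := concentration_le_lambda0 hc' f
  rw [hf] at h2
  linarith

theorem lambda0_nonneg {c : ℝ} (hc : 0 ≤ c) : 0 ≤ lambda0 c := by
  obtain ⟨f, -, hfc⟩ := (exists_concentration_eq_lambda0 hc).2.1
  exact hfc ▸ concentration_nonneg c f

/-- A maximizer for `c` gains energy strictly when the band is widened to `c + 1`, and even then has
at most its total energy `1`. -/
theorem lambda0_lt_one {c : ℝ} (hc : 0 ≤ c) : lambda0 c < 1 := by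
  obtain ⟨f, hf, hfc⟩ := (exists_concentration_eq_lambda0 hc).2.1
  have h1 := concentration_strictMono hc (lt_add_one c) (norm_ne_zero_iff.1 (hf ▸ one_ne_zero))
  have h2 := concentration_le (c + 1) f
  rw [hf] at h2
  linarith

theorem lambda0_zero : lambda0 0 = 0 := by
  obtain ⟨f, -, hfc⟩ := (exists_concentration_eq_lambda0 le_rfl).2.1
  rw [← hfc, concentration_zero]

theorem lambda0_sub_le {c c' : ℝ} (hc : 0 ≤ c) (hcc' : c ≤ c') :
    lambda0 c' - lambda0 c ≤ c' - c := by
  obtain ⟨f, hf, hfc⟩ := (exists_concentration_eq_lambda0 (hc.trans hcc')).2.1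
  have h1 := concentration_sub_le hc hcc' f
  have h2 := concentration_le_lambda0 hc f
  rw [hf] at h1 h2
  linarith

theorem continuousOn_lambda0 : ContinuousOn lambda0 (Ici 0) := by
  refine LipschitzOnWith.continuousOn (K := 1) (LipschitzOnWith.of_dist_le_mul ?_)
  intro x hx y hy
  rw [NNReal.coe_one, one_mul, Real.dist_eq, Real.dist_eq]
  rcases le_total x y with h | h
  · have h1 := lambda0_sub_le hx h
    have h2 := lambda0_strictMonoOn.monotoneOn hx hy h
    rw [abs_of_nonpos (by linarith), abs_of_nonpos (by linarith)]
    linarith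
  · have h1 := lambda0_sub_le hy h
    have h2 := lambda0_strictMonoOn.monotoneOn hy hx h
    rw [abs_of_nonneg (by linarith), abs_of_nonneg (by linarith)]
    exact h1

/-- Surjectivity is the intermediate value theorem: any fixed unit vector has concentration tending
to `1`, which pushes `lambda0` above every `t < 1`. -/
theorem lambda0_bijOn : BijOn lambda0 (Ici 0) (Ico 0 1) := by
  refine ⟨fun c hc => ⟨lambda0_nonneg hc, lambda0_lt_one hc⟩, lambda0_strictMonoOn.injOn, ?_⟩
  intro t ht
  obtain ⟨f, hf⟩ := exists_norm_eq_one
  have htend := tendsto_concentration f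
  rw [hf, one_pow] at htend
  obtain ⟨c, hct, hc⟩ := ((htend.eventually (lt_mem_nhds ht.2)).and (eventually_ge_atTop 0)).exists
  have h1 : t ≤ lambda0 c := by
    have := concentration_le_lambda0 hc f
    rw [hf] at this
    linarith
  obtain ⟨x, hx, hxt⟩ := intermediate_value_Icc hc (continuousOn_lambda0.mono Icc_subset_Ici_self)
    ⟨lambda0_zero.trans_le ht.1, h1⟩
  exact ⟨x, hx.1, hxt⟩

/-! ### The Landau–Pollak inequality -/

section AngularTarget

variable {θx θp : ℝ}

theorem sqrt_mul_sub_sqrt_pos (hx1 : θx ≤ 1) (hp1 : θp ≤ 1)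
    (hsum : 1 < θx + θp) : 0 < √(θx * θp) - √((1 - θx) * (1 - θp)) := by
  refine sub_pos.2 (Real.sqrt_lt_sqrt (mul_nonneg (by linarith) (by linarith)) ?_)
  linarith

theorem angularTarget_pos (hx1 : θx ≤ 1) (hp1 : θp ≤ 1)
    (hsum : 1 < θx + θp) : 0 < angularTarget θx θp :=
  pow_pos (sqrt_mul_sub_sqrt_pos hx1 hp1 hsum) 2

/-- The Landau–Pollak inequality for the orthogonal projections `h`, `k` of a unit vector `ψ` on
two subspaces. -/
theorem angularTarget_le_of_projections {E : Type*} [NormedAddCommGroup E] [InnerProductSpace ℂ E]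
    {ψ h k : E} {μ : ℝ} (hx : 0 < θx) (hx1 : θx ≤ 1) (hp : 0 < θp) (hp1 : θp ≤ 1)
    (hsum : 1 < θx + θp) (hψ : ‖ψ‖ = 1) (hh : inner ℂ h ψ = ((‖h‖ ^ 2 : ℝ) : ℂ))
    (hk : inner ℂ k ψ = ((‖k‖ ^ 2 : ℝ) : ℂ)) (hθx : θx ≤ ‖h‖ ^ 2) (hθp : θp ≤ ‖k‖ ^ 2)
    (hμ : ‖(inner ℂ h k : ℂ)‖ ^ 2 ≤ μ * (‖h‖ ^ 2 * ‖k‖ ^ 2)) : angularTarget θx θp ≤ μ := by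
  -- The vector `v - ‖v‖²ψ` is the component of `v` orthogonal to `ψ`. Cauchy–Schwarz for these
  -- components of `h` and `k` bounds the distance from `⟨h, k⟩` to `‖h‖²‖k‖²`.
  have hdefect : ∀ v : E, inner ℂ v ψ = ((‖v‖ ^ 2 : ℝ) : ℂ) →
      ‖v - ((‖v‖ ^ 2 : ℝ) : ℂ) • ψ‖ ^ 2 = ‖v‖ ^ 2 * (1 - ‖v‖ ^ 2) := by
    intro v hv
    rw [@norm_sub_sq ℂ, inner_smul_right, hv, norm_smul, hψ, Complex.norm_real, mul_one,
      Real.norm_eq_abs, sq_abs, ← Complex.ofReal_mul]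
    simp only [RCLike.re_to_complex, Complex.ofReal_re]
    ring
  have hle : ∀ v : E, inner ℂ v ψ = ((‖v‖ ^ 2 : ℝ) : ℂ) → 0 < ‖v‖ ^ 2 → ‖v‖ ^ 2 ≤ 1 := by
    intro v hv hpos
    have h1 : 0 ≤ ‖v‖ ^ 2 * (1 - ‖v‖ ^ 2) := by rw [← hdefect v hv]; positivity
    nlinarith
  have ha1 := hle h hh (hx.trans_le hθx)
  have hb1 := hle k hk (hp.trans_le hθp)
  have hk' : inner ℂ ψ k = ((‖k‖ ^ 2 : ℝ) : ℂ) := by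
    rw [← inner_conj_symm, hk, Complex.conj_ofReal]
  have hinner : inner ℂ (h - ((‖h‖ ^ 2 : ℝ) : ℂ) • ψ) (k - ((‖k‖ ^ 2 : ℝ) : ℂ) • ψ) =
      inner ℂ h k - ((‖h‖ ^ 2 * ‖k‖ ^ 2 : ℝ) : ℂ) := by
    simp only [inner_sub_left, inner_sub_right, inner_smul_left, inner_smul_right, hh, hk',
      inner_self_eq_norm_sq_to_K (𝕜 := ℂ) ψ, hψ, Complex.conj_ofReal]
    push_cast
    ring
  have hCS := norm_inner_le_norm (𝕜 := ℂ) (h - ((‖h‖ ^ 2 : ℝ) : ℂ) • ψ)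
    (k - ((‖k‖ ^ 2 : ℝ) : ℂ) • ψ)
  have hsqrt : ∀ v : E, inner ℂ v ψ = ((‖v‖ ^ 2 : ℝ) : ℂ) →
      ‖v - ((‖v‖ ^ 2 : ℝ) : ℂ) • ψ‖ = ‖v‖ * √(1 - ‖v‖ ^ 2) := by
    intro v hv
    rw [← Real.sqrt_sq (norm_nonneg (v - _)), hdefect v hv, Real.sqrt_mul (by positivity),
      Real.sqrt_sq (norm_nonneg _)]
  rw [hinner, hsqrt h hh, hsqrt k hk] at hCS
  have h1 : ‖h‖ ^ 2 * ‖k‖ ^ 2 - ‖(inner ℂ h k : ℂ)‖ ≤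
      ‖(inner ℂ h k : ℂ) - ((‖h‖ ^ 2 * ‖k‖ ^ 2 : ℝ) : ℂ)‖ := by
    have := norm_sub_norm_le (((‖h‖ ^ 2 * ‖k‖ ^ 2 : ℝ) : ℂ)) (inner ℂ h k)
    rwa [Complex.norm_real, Real.norm_of_nonneg (by positivity), norm_sub_rev] at this
  have ha : 0 < ‖h‖ :=
    lt_of_pow_lt_pow_left₀ 2 (norm_nonneg _) (by simpa using hx.trans_le hθx)
  have hb : 0 < ‖k‖ :=
    lt_of_pow_lt_pow_left₀ 2 (norm_nonneg _) (by simpa using hp.trans_le hθp)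
  have hτ := sqrt_mul_sub_sqrt_pos hx1 hp1 hsum
  have h2 : √(θx * θp) - √((1 - θx) * (1 - θp)) ≤
      ‖h‖ * ‖k‖ - √(1 - ‖h‖ ^ 2) * √(1 - ‖k‖ ^ 2) := by
    have e1 : √(θx * θp) ≤ ‖h‖ * ‖k‖ := by
      refine Real.sqrt_le_iff.2 ⟨by positivity, ?_⟩
      rw [mul_pow]
      gcongr
    have e2 : √(1 - ‖h‖ ^ 2) * √(1 - ‖k‖ ^ 2) ≤ √((1 - θx) * (1 - θp)) := by
      rw [← Real.sqrt_mul (by linarith)]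
      refine Real.sqrt_le_sqrt (mul_le_mul ?_ ?_ ?_ ?_) <;> linarith
    linarith
  -- The left side is nonnegative because `1 < θx + θp`, which permits the squaring that follows.
  have h3 : ‖h‖ * ‖k‖ * (√(θx * θp) - √((1 - θx) * (1 - θp))) ≤ ‖(inner ℂ h k : ℂ)‖ := by
    refine (mul_le_mul_of_nonneg_left h2 (by positivity)).trans ?_
    linarith
  have h4 := (pow_le_pow_left₀ (by positivity) h3 2).trans hμ
  have h5 : angularTarget θx θp * (‖h‖ ^ 2 * ‖k‖ ^ 2) ≤ μ * (‖h‖ ^ 2 * ‖k‖ ^ 2) := by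
    rw [angularTarget]
    linarith
  exact le_of_mul_le_mul_right h5 (by positivity)

/-- The Landau–Pollak inequality for a state with prescribed mass in a set of positions and a set
of frequencies. -/
theorem angularTarget_le_of_sets {ψ : L2R} {X S : Set ℝ} {μ : ℝ} (hx : 0 < θx) (hx1 : θx ≤ 1)
    (hp : 0 < θp) (hp1 : θp ≤ 1) (hsum : 1 < θx + θp) (hψ : ‖ψ‖ = 1)
    (hX : NullMeasurableSet X) (hS : NullMeasurableSet S) (hθx : θx ≤ ∫ x in X, ‖ψ x‖ ^ 2)
    (hθp : θp ≤ ∫ ξ in S, ‖(𝓕 ψ : L2R) ξ‖ ^ 2)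
    (hμ : ∀ h : L2R, (∀ᵐ x, x ∉ X → h x = 0) → ∫ ξ in S, ‖(𝓕 h : L2R) ξ‖ ^ 2 ≤ μ * ‖h‖ ^ 2) :
    angularTarget θx θp ≤ μ := by
  obtain ⟨h, hh⟩ := exists_indicator hX ψ
  obtain ⟨k, hk⟩ := exists_indicator hS (𝓕 ψ : L2R)
  have hinv : ∀ g : L2R, inner ℂ (𝓕⁻ k : L2R) g = inner ℂ k (𝓕 g : L2R) := fun g => by
    rw [← Lp.inner_fourier_eq, FourierTransform.fourier_fourierInv_eq]
  have hnorm : ‖(𝓕⁻ k : L2R)‖ = ‖k‖ := by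
    rw [← Lp.norm_fourier_eq, FourierTransform.fourier_fourierInv_eq]
  refine angularTarget_le_of_projections (h := h) (k := (𝓕⁻ k : L2R)) hx hx1 hp hp1 hsum hψ
    (inner_indicator_self hX hh) ?_ ?_ ?_ ?_
  · rw [hinv, hnorm, inner_indicator_self hS hk]
  · rwa [norm_sq_indicator hX hh]
  · rwa [hnorm, norm_sq_indicator hS hk]
  · rw [norm_inner_symm, hinv, hnorm]
    refine (norm_inner_indicator_sq_le hS hk _).trans ?_
    refine (mul_le_mul_of_nonneg_left (hμ h ?_) (by positivity)).trans_eq (by ring)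
    filter_upwards [hh] with x hx hx'
    rw [hx, indicator_of_notMem hx']

end AngularTarget

/-! ### Momentum sets and frequency sets -/

section Momentum

variable {hbar : ℝ}

/-- The frequencies, in Mathlib's normalization, that correspond to a set of momenta. -/
def frequencySet (hbar : ℝ) (P : Set ℝ) : Set ℝ := (fun ξ => 2 * Real.pi * hbar * ξ) ⁻¹' P

theorem nullMeasurableSet_frequencySet (hbar_pos : 0 < hbar) {P : Set ℝ}
    (hP : NullMeasurableSet P) : NullMeasurableSet (frequencySet hbar P) := by
  have hpi := Real.pi_pos
  exact hP.preimage (quasiMeasurePreserving_mul_left (by positivity))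

theorem volume_frequencySet (hbar_pos : 0 < hbar) (P : Set ℝ) :
    volume (frequencySet hbar P) = ENNReal.ofReal (2 * Real.pi * hbar)⁻¹ * volume P := by
  have hpi := Real.pi_pos
  rw [frequencySet, Real.volume_preimage_mul_left (by positivity), abs_of_pos (by positivity)]

theorem frequencySet_Icc (hbar_pos : 0 < hbar) (a b : ℝ) : frequencySet hbar (Icc a b) =
    Icc (a / (2 * Real.pi * hbar)) (b / (2 * Real.pi * hbar)) := by
  have hpi := Real.pi_pos
  ext ξ
  rw [frequencySet, mem_preimage, mem_Icc, mem_Icc, div_le_iff₀' (by positivity),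
    le_div_iff₀' (by positivity)]

theorem norm_momentumWave_sq (hbar_pos : 0 < hbar) (ψ : L2R) (p : ℝ) :
    ‖momentumWave hbar ψ p‖ ^ 2 =
      (2 * Real.pi * hbar)⁻¹ * ‖(𝓕 ψ : L2R) (p / (2 * Real.pi * hbar))‖ ^ 2 := by
  have hpi := Real.pi_pos
  rw [momentumWave, norm_mul, mul_pow, Complex.norm_real, Real.norm_eq_abs, sq_abs, div_pow,
    Real.sq_sqrt (by positivity), one_pow, one_div]

theorem integrable_norm_momentumWave_sq (hbar_pos : 0 < hbar) (ψ : L2R) :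
    Integrable fun p => ‖momentumWave hbar ψ p‖ ^ 2 := by
  have hpi := Real.pi_pos
  simp only [norm_momentumWave_sq hbar_pos]
  exact (Integrable.comp_div (integrable_norm_sq (𝓕 ψ : L2R))
    (by positivity : 2 * Real.pi * hbar ≠ 0)).const_mul _

theorem setIntegral_momentumWave (hbar_pos : 0 < hbar) (ψ : L2R) {P : Set ℝ}
    (hP : NullMeasurableSet P) : ∫ p in P, ‖momentumWave hbar ψ p‖ ^ 2 =
      ∫ ξ in frequencySet hbar P, ‖(𝓕 ψ : L2R) ξ‖ ^ 2 := by
  have hpi := Real.pi_pos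
  have hne : 2 * Real.pi * hbar ≠ 0 := by positivity
  rw [← integral_indicator₀ hP, ← integral_indicator₀ (nullMeasurableSet_frequencySet hbar_pos hP)]
  have h1 : ∀ p, P.indicator (fun p => ‖momentumWave hbar ψ p‖ ^ 2) p = (2 * Real.pi * hbar)⁻¹ *
      (frequencySet hbar P).indicator (fun ξ => ‖(𝓕 ψ : L2R) ξ‖ ^ 2) (p / (2 * Real.pi * hbar)) := by
    intro p
    have hmem : p / (2 * Real.pi * hbar) ∈ frequencySet hbar P ↔ p ∈ P := by
      rw [frequencySet, mem_preimage, mul_div_cancel₀ _ hne]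
    by_cases hp : p ∈ P
    · rw [indicator_of_mem hp, indicator_of_mem (hmem.2 hp), norm_momentumWave_sq hbar_pos]
    · rw [indicator_of_notMem hp, indicator_of_notMem (mt hmem.1 hp), mul_zero]
  simp only [h1]
  rw [integral_const_mul, Measure.integral_comp_div, smul_eq_mul, abs_of_pos (by positivity),
    inv_mul_cancel_left₀ hne]

/-- The concentration of a state supported in a bounded interval on a momentum interval. -/
theorem setIntegral_fourier_le_lambda0 (hbar_pos : 0 < hbar) {x₁ x₂ p₁ p₂ : ℝ} (hx : x₁ < x₂)
    (hp : p₁ ≤ p₂) {h : L2R} (hh : ∀ᵐ x, x ∉ Icc x₁ x₂ → h x = 0) :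
    ∫ ξ in frequencySet hbar (Icc p₁ p₂), ‖(𝓕 h : L2R) ξ‖ ^ 2 ≤
      lambda0 ((x₂ - x₁) * (p₂ - p₁) / (4 * hbar)) * ‖h‖ ^ 2 := by
  have hpi := Real.pi_pos
  have hl : 0 < (x₂ - x₁) / 2 := by linarith
  rw [frequencySet_Icc hbar_pos]
  obtain ⟨f, hf⟩ := exists_isPullback ((x₁ + x₂) / 2) hl (Real.pi * ((x₂ - x₁) / 2) *
    (p₁ / (2 * Real.pi * hbar) + p₂ / (2 * Real.pi * hbar))) h
  have hh' : ∀ᵐ x, x ∉ Icc ((x₁ + x₂) / 2 - (x₂ - x₁) / 2) ((x₁ + x₂) / 2 + (x₂ - x₁) / 2) →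
      h x = 0 := by
    ring_nf at hh ⊢
    exact hh
  rw [hf.setIntegral_fourier hl (by gcongr) hh', ← hf.norm_eq hl hh']
  have hc : Real.pi * ((x₂ - x₁) / 2) * (p₂ / (2 * Real.pi * hbar) - p₁ / (2 * Real.pi * hbar)) =
      (x₂ - x₁) * (p₂ - p₁) / (4 * hbar) := by
    field_simp
    ring
  rw [hc]
  exact concentration_le_lambda0
    (div_nonneg (mul_nonneg (by linarith) (by linarith)) (by linarith)) f

end Momentum

/-- A value of the transform is the inner product of `h` with an exponential cut off to `X`, whose
squared norm is the measure of `X`. -/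
theorem norm_fourier_sq_le_of_support {X : Set ℝ} (hX : MeasurableSet X) (hXfin : volume X ≠ ⊤)
    {h : L2R} (hh : ∀ᵐ x, x ∉ X → h x = 0) :
    ∀ᵐ ξ : ℝ, ‖(𝓕 h : L2R) ξ‖ ^ 2 ≤ volume.real X * ‖h‖ ^ 2 := by
  have hfin : IsFiniteMeasure (volume.restrict X) := ⟨by simpa using hXfin.lt_top⟩
  have hint : Integrable h := by
    have h1 : Integrable h (volume.restrict X) :=
      ((Lp.memLp h).restrict _).integrable (by norm_num)
    refine (integrable_indicator_iff hX).2 h1 |>.congr ?_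
    filter_upwards [hh] with x hx
    by_cases hx' : x ∈ X <;> simp [hx', hx]
  filter_upwards [fourier_ae_eq_of_integrable h hint] with ξ hξ
  have hnorm : ∀ x : ℝ, ‖Complex.exp (((2 * Real.pi * x * ξ : ℝ) : ℂ) * Complex.I)‖ = 1 :=
    fun x => Complex.norm_exp_ofReal_mul_I _
  have hm : MemLp (X.indicator fun x : ℝ =>
      Complex.exp (((2 * Real.pi * x * ξ : ℝ) : ℂ) * Complex.I)) 2 volume :=
    (memLp_indicator_iff_restrict hX).2 (MemLp.of_bound
      (Continuous.aestronglyMeasurable (by fun_prop)) 1 (.of_forall fun x => (hnorm x).le))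
  have h1 : (𝓕 h : L2R) ξ = inner ℂ (hm.toLp _) h := by
    rw [hξ, Real.fourier_real_eq_integral_exp_smul, L2.inner_def]
    refine integral_congr_ae ?_
    filter_upwards [hh, hm.coeFn_toLp] with x hx hx'
    rw [hx']
    by_cases hxX : x ∈ X
    · rw [indicator_of_mem hxX, RCLike.inner_apply, ← Complex.exp_conj, smul_eq_mul, mul_comm,
        map_mul, Complex.conj_ofReal, Complex.conj_I]
      congr 2
      push_cast
      ring
    · rw [hx hxX, smul_zero, inner_zero_right]
  have h2 : ‖hm.toLp _‖ ^ 2 = volume.real X := by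
    rw [norm_sq_eq_integral]
    have : ∫ x, ‖hm.toLp _ x‖ ^ 2 = ∫ x, X.indicator (fun _ => (1 : ℝ)) x := by
      refine integral_congr_ae ?_
      filter_upwards [hm.coeFn_toLp] with x hx
      rw [hx]
      by_cases hxX : x ∈ X
      · rw [indicator_of_mem hxX, indicator_of_mem hxX, hnorm, one_pow]
      · simp [hxX]
    rw [this, integral_indicator hX]
    simp
  rw [h1, ← h2, ← mul_pow]
  gcongr
  exact norm_inner_le_norm _ _

/-! ### Widths as infima -/

section Widths

variable {w : ℝ → ℂ} {θ : ℝ}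

theorem isGLB_confidenceWidth (w : ℝ → ℂ) (θ : ℝ) :
    IsGLB {v : ℝ≥0∞ | ∃ X : Set ℝ, NullMeasurableSet X volume ∧ θ ≤ ∫ x in X, ‖w x‖ ^ 2 ∧
      v = volume X} (confidenceWidth w θ) := by
  constructor
  · rintro _ ⟨X, hX, hθ, rfl⟩
    exact iInf_le_of_le X (iInf₂_le hX hθ)
  · intro b hb
    exact le_iInf fun X => le_iInf₂ fun hX hθ => hb ⟨X, hX, hθ, rfl⟩

theorem isGLB_intervalWidth (w : ℝ → ℂ) (θ : ℝ) :
    IsGLB {v : ℝ≥0∞ | ∃ x₁ x₂ : ℝ, x₁ ≤ x₂ ∧ θ ≤ ∫ x in Icc x₁ x₂, ‖w x‖ ^ 2 ∧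
      v = ENNReal.ofReal (x₂ - x₁)} (intervalWidth w θ) := by
  constructor
  · rintro _ ⟨x₁, x₂, hx, hθ, rfl⟩
    exact iInf_le_of_le x₁ (iInf_le_of_le x₂ (iInf₂_le hx hθ))
  · intro b hb
    exact le_iInf fun x₁ => le_iInf fun x₂ => le_iInf₂ fun hx hθ => hb ⟨x₁, x₂, hx, hθ, rfl⟩

theorem confidenceWidth_le_intervalWidth (w : ℝ → ℂ) (θ : ℝ) :
    confidenceWidth w θ ≤ intervalWidth w θ := by
  refine (isGLB_intervalWidth w θ).2 ?_
  rintro _ ⟨x₁, x₂, hx, hθ, rfl⟩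
  exact (isGLB_confidenceWidth w θ).1
    ⟨Icc x₁ x₂, measurableSet_Icc.nullMeasurableSet, hθ, Real.volume_Icc.symm⟩

/-- Absolute continuity of the integral: sets of small measure carry mass less than `θ`. -/
theorem confidenceWidth_ne_zero (hw : Integrable fun x => ‖w x‖ ^ 2) (hθ : 0 < θ) :
    confidenceWidth w θ ≠ 0 := by
  have h1 : Tendsto (fun X : Set ℝ => ∫ x in X, ‖w x‖ ^ 2) (comap volume (𝓝 (0 : ℝ≥0∞))) (𝓝 0) :=
    hw.tendsto_setIntegral_nhds_zero tendsto_comap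
  obtain ⟨ε, hε, h2⟩ := (ENNReal.nhds_zero_basis.comap _).eventually_iff.1
    (h1.eventually (gt_mem_nhds hθ))
  refine (hε.trans_le ((isGLB_confidenceWidth w θ).2 ?_)).ne'
  rintro _ ⟨X, -, hX, rfl⟩
  by_contra! h
  exact hX.not_gt (h2 h)

theorem intervalWidth_ne_zero (hw : Integrable fun x => ‖w x‖ ^ 2) (hθ : 0 < θ) :
    intervalWidth w θ ≠ 0 :=
  ((pos_iff_ne_zero.2 (confidenceWidth_ne_zero hw hθ)).trans_le
    (confidenceWidth_le_intervalWidth w θ)).ne'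

end Widths

/-- Passes a bound for all admissible pairs to the product of infima. The infima must be nonzero
since `0 * ⊤ = 0`. -/
theorem le_mul_of_isGLB {A B : Set ℝ≥0∞} {a b K : ℝ≥0∞} (ha : IsGLB A a) (hb : IsGLB B b)
    (ha0 : a ≠ 0) (hb0 : b ≠ 0) (h : ∀ x ∈ A, ∀ y ∈ B, K ≤ x * y) : K ≤ a * b := by
  have h1 : ∀ y ∈ B, K ≤ a * y := by
    intro y hy
    have hy0 : y ≠ 0 := ((pos_iff_ne_zero.2 hb0).trans_le (hb.1 hy)).ne'
    rcases eq_or_ne y ⊤ with rfl | hyt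
    · rw [ENNReal.mul_top ha0]
      exact le_top
    rw [← ENNReal.div_le_iff hy0 hyt]
    exact ha.2 fun x hx => (ENNReal.div_le_iff hy0 hyt).2 (h x hx y hy)
  rcases eq_or_ne a ⊤ with rfl | hat
  · rw [ENNReal.top_mul hb0]
    exact le_top
  rw [mul_comm, ← ENNReal.div_le_iff ha0 hat]
  exact hb.2 fun y hy => (ENNReal.div_le_iff ha0 hat).2 (by rw [mul_comm]; exact h1 y hy)

/-! ### The uncertainty bounds -/

section Bounds

variable {hbar θx θp : ℝ} {ψ : L2R}

theorem confX_mul_confP_ge (hbar_pos : 0 < hbar) (hx : 0 < θx) (hx1 : θx ≤ 1) (hp : 0 < θp)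
    (hp1 : θp ≤ 1) (hsum : 1 < θx + θp) (hψ : ‖ψ‖ = 1) :
    ENNReal.ofReal (2 * Real.pi * hbar * angularTarget θx θp) ≤ confX ψ θx * confP hbar ψ θp := by
  have hpi := Real.pi_pos
  have hX0 : confX ψ θx ≠ 0 := confidenceWidth_ne_zero (integrable_norm_sq ψ) hx
  have hP0 : confP hbar ψ θp ≠ 0 :=
    confidenceWidth_ne_zero (integrable_norm_momentumWave_sq hbar_pos ψ) hp
  refine le_mul_of_isGLB (isGLB_confidenceWidth _ _) (isGLB_confidenceWidth _ _) hX0 hP0 ?_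
  rintro _ ⟨X, hX, hθX, rfl⟩ _ ⟨P, hP, hθP, rfl⟩
  have hX0' : volume X ≠ 0 := ((pos_iff_ne_zero.2 hX0).trans_le
    ((isGLB_confidenceWidth _ _).1 ⟨X, hX, hθX, rfl⟩)).ne'
  have hP0' : volume P ≠ 0 := ((pos_iff_ne_zero.2 hP0).trans_le
    ((isGLB_confidenceWidth _ _).1 ⟨P, hP, hθP, rfl⟩)).ne'
  rcases eq_or_ne (volume X) ⊤ with hXt | hXt
  · rw [hXt, ENNReal.top_mul hP0']
    exact le_top
  rcases eq_or_ne (volume P) ⊤ with hPt | hPt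
  · rw [hPt, ENNReal.mul_top hX0']
    exact le_top
  rw [setIntegral_momentumWave hbar_pos ψ hP] at hθP
  -- The set `X` is only null measurable; its measurable hull has the same measure and the same
  -- mass.
  rw [← setIntegral_congr_set hX.toMeasurable_ae_eq] at hθX
  have hSt : volume (frequencySet hbar P) ≠ ⊤ := by
    rw [volume_frequencySet hbar_pos]
    exact ENNReal.mul_ne_top ENNReal.ofReal_ne_top hPt
  have hXm := measurableSet_toMeasurable volume X
  have key := angularTarget_le_of_sets (μ := volume.real X * volume.real (frequencySet hbar P))
    hx hx1 hp hp1 hsum hψ hXm.nullMeasurableSet (nullMeasurableSet_frequencySet hbar_pos hP)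
    hθX hθP (fun h hh => by
      have h1 := norm_fourier_sq_le_of_support hXm (by rwa [measure_toMeasurable]) hh
      rw [measureReal_def, measure_toMeasurable, ← measureReal_def] at h1
      have h2 := setIntegral_mono_ae (s := frequencySet hbar P)
        (integrable_norm_sq (𝓕 h : L2R)).integrableOn (integrableOn_const hSt) h1
      refine h2.trans_eq ?_
      rw [setIntegral_const, smul_eq_mul]
      ring)
  rw [ENNReal.ofReal_le_iff_le_toReal (ENNReal.mul_ne_top hXt hPt), ENNReal.toReal_mul,
    ← measureReal_def, ← measureReal_def]
  have hS : volume.real (frequencySet hbar P) = (2 * Real.pi * hbar)⁻¹ * volume.real P := by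
    rw [measureReal_def, volume_frequencySet hbar_pos, ENNReal.toReal_mul,
      ENNReal.toReal_ofReal (by positivity), ← measureReal_def]
  rw [hS] at key
  calc _ ≤ 2 * Real.pi * hbar * (volume.real X * ((2 * Real.pi * hbar)⁻¹ * volume.real P)) := by
        gcongr
    _ = _ := by field_simp

theorem intX_mul_intP_ge (hbar_pos : 0 < hbar) (hx : 0 < θx) (hx1 : θx ≤ 1) (hp : 0 < θp)
    (hp1 : θp ≤ 1) (hsum : 1 < θx + θp) (hψ : ‖ψ‖ = 1) :
    ENNReal.ofReal (4 * hbar) * lambda0Inv (angularTarget θx θp) ≤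
      intX ψ θx * intP hbar ψ θp := by
  have hX0 : intX ψ θx ≠ 0 := intervalWidth_ne_zero (integrable_norm_sq ψ) hx
  have hP0 : intP hbar ψ θp ≠ 0 :=
    intervalWidth_ne_zero (integrable_norm_momentumWave_sq hbar_pos ψ) hp
  refine le_mul_of_isGLB (isGLB_intervalWidth _ _) (isGLB_intervalWidth _ _) hX0 hP0 ?_
  rintro _ ⟨x₁, x₂, hx12, hθX, rfl⟩ _ ⟨p₁, p₂, hp12, hθP, rfl⟩
  -- A point carries no mass. Positive length is needed to rescale to `[-1,1]`; the momentum
  -- interval may be degenerate.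
  have hx12' : x₁ < x₂ := by
    refine hx12.lt_of_ne ?_
    rintro rfl
    rw [Icc_self, Measure.restrict_singleton] at hθX
    simp at hθX
    linarith
  rw [setIntegral_momentumWave hbar_pos ψ measurableSet_Icc.nullMeasurableSet] at hθP
  have key := angularTarget_le_of_sets hx hx1 hp hp1 hsum hψ measurableSet_Icc.nullMeasurableSet
    (nullMeasurableSet_frequencySet hbar_pos measurableSet_Icc.nullMeasurableSet) hθX hθP
    (fun h hh => setIntegral_fourier_le_lambda0 hbar_pos hx12' hp12 hh)
  have hc : 0 ≤ (x₂ - x₁) * (p₂ - p₁) / (4 * hbar) :=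
    div_nonneg (mul_nonneg (by linarith) (by linarith)) (by linarith)
  have h1 : lambda0Inv (angularTarget θx θp) ≤
      ENNReal.ofReal ((x₂ - x₁) * (p₂ - p₁) / (4 * hbar)) :=
    iInf₂_le (Real.toNNReal ((x₂ - x₁) * (p₂ - p₁) / (4 * hbar)))
      (by rwa [Real.coe_toNNReal _ hc])
  refine (mul_le_mul_right h1 _).trans_eq ?_
  rw [← ENNReal.ofReal_mul (by positivity), ← ENNReal.ofReal_mul (by linarith)]
  congr 1
  field_simp

/-- Where it is finite, `lambda0Inv` inverts `lambda0`. -/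
theorem exists_lambda0_eq_of_lambda0Inv_ne_top {t : ℝ} (ht : 0 ≤ t) (h : lambda0Inv t ≠ ⊤) :
    ∃ c : ℝ, 0 ≤ c ∧ lambda0 c = t ∧ lambda0Inv t = ENNReal.ofReal c := by
  obtain ⟨b, hb⟩ : ∃ b : ℝ≥0, t ≤ lambda0 b := by
    by_contra! hcon
    refine h ?_
    rw [lambda0Inv]
    simp [fun c => (hcon c).not_ge]
  obtain ⟨c, hc, hct⟩ := lambda0_bijOn.surjOn ⟨ht, hb.trans_lt (lambda0_lt_one b.2)⟩
  have hc0 : 0 ≤ c := hc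
  refine ⟨c, hc, hct, le_antisymm ?_ (le_iInf₂ fun d hd => ?_)⟩
  · exact iInf₂_le (Real.toNNReal c) (by rw [Real.coe_toNNReal _ hc0, hct])
  · rw [← hct] at hd
    exact (ENNReal.ofReal_le_ofReal ((lambda0_strictMonoOn.le_iff_le hc d.2).1 hd)).trans_eq
      ENNReal.ofReal_coe_nnreal

theorem angularTarget_le_lambda0 (hbar_pos : 0 < hbar) (hx : 0 < θx) (hx1 : θx ≤ 1) (hp : 0 < θp)
    (hp1 : θp ≤ 1) (hsum : 1 < θx + θp) (hψ : ‖ψ‖ = 1) (hfin : intX ψ θx * intP hbar ψ θp ≠ ⊤) :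
    angularTarget θx θp ≤ lambda0 ((intX ψ θx * intP hbar ψ θp).toReal / (4 * hbar)) := by
  have hle := intX_mul_intP_ge hbar_pos hx hx1 hp hp1 hsum hψ
  have h4 : 0 < 4 * hbar := by positivity
  have htop : lambda0Inv (angularTarget θx θp) ≠ ⊤ := by
    intro h
    rw [h, ENNReal.mul_top (by simpa using h4)] at hle
    exact hfin (top_le_iff.1 hle)
  obtain ⟨c, hc, hct, hc'⟩ := exists_lambda0_eq_of_lambda0Inv_ne_top
    (angularTarget_pos hx1 hp1 hsum).le htop
  rw [hc', ← ENNReal.ofReal_mul h4.le, ENNReal.ofReal_le_iff_le_toReal hfin] at hle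
  have hle' : c ≤ (intX ψ θx * intP hbar ψ θp).toReal / (4 * hbar) := by
    rw [le_div_iff₀' h4]
    exact hle
  rw [← hct]
  exact lambda0_strictMonoOn.monotoneOn hc (hc.trans hle') hle'

end Bounds

/-! ### Saturation of the interval bound -/

section Saturation

variable {hbar L W : ℝ}

theorem exists_isRescaled (hL : 0 < L) (f : L2I) : ∃ e : L2R, IsRescaled L f e := by
  obtain ⟨h, hh⟩ := exists_zeroExtension f
  have h2L : 2 / L ≠ 0 := by positivity
  have hm := (memLp_comp_affine (Lp.memLp h) 0 h2L).const_mul ((√(2 / L) : ℝ) : ℂ)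
  refine ⟨hm.toLp _, ?_⟩
  filter_upwards [hm.coeFn_toLp, ae_comp_affine hh 0 h2L] with x hx hx'
  have hx2 : 0 + 2 / L * x = 2 * x / L := by ring
  have hmem : 2 * x / L ∈ Icc (-1 : ℝ) 1 ↔ x ∈ Icc (-(L / 2)) (L / 2) := by
    rw [mem_Icc, mem_Icc, le_div_iff₀ hL, div_le_iff₀ hL]
    constructor <;> rintro ⟨h1, h2⟩ <;> constructor <;> linarith
  rw [hx, hx', hx2]
  by_cases hxm : x ∈ Icc (-(L / 2)) (L / 2)
  · rw [indicator_of_mem hxm, indicator_of_mem (hmem.2 hxm)]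
  · rw [indicator_of_notMem hxm, indicator_of_notMem (mt hmem.1 hxm), mul_zero]

theorem IsRescaled.ae_eq_zero {f : L2I} {e : L2R} (he : IsRescaled L f e) :
    ∀ᵐ x, x ∉ Icc (-(L / 2)) (L / 2) → e x = 0 := by
  filter_upwards [he] with x hx hx'
  rw [hx, indicator_of_notMem hx']

theorem IsRescaled.isPullback (hL : 0 < L) {f : L2I} {e : L2R} (he : IsRescaled L f e) :
    IsPullback 0 (L / 2) 0 e f := by
  filter_upwards [ae_restrict_of_ae (ae_comp_affine he 0 (half_pos hL).ne'),
    ae_restrict_mem measurableSet_Icc] with u hu hu'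
  have hmem : 0 + L / 2 * u ∈ Icc (-(L / 2)) (L / 2) := by
    constructor <;> nlinarith [hu'.1, hu'.2]
  have h1 : 2 * (0 + L / 2 * u) / L = u := by
    field_simp
    ring
  have h2 : √(L / 2) * √(2 / L) = 1 := by
    rw [← Real.sqrt_mul (by positivity), show L / 2 * (2 / L) = 1 by field_simp, Real.sqrt_one]
  rw [hu, indicator_of_mem hmem, h1]
  simp only [Complex.ofReal_zero, mul_zero, zero_mul, neg_zero, Complex.exp_zero, one_mul]
  rw [← mul_assoc, ← Complex.ofReal_mul, h2, Complex.ofReal_one, one_mul]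

theorem IsRescaled.norm_eq (hL : 0 < L) {f : L2I} {e : L2R} (he : IsRescaled L f e) :
    ‖e‖ = ‖f‖ := by
  refine ((he.isPullback hL).norm_eq (half_pos hL) ?_).symm
  simpa only [zero_sub, zero_add] using he.ae_eq_zero

theorem IsRescaled.setIntegral_fourier (hbar_pos : 0 < hbar) (hL : 0 < L) (hW : 0 < W) {f : L2I}
    {e : L2R} (he : IsRescaled L f e) :
    ∫ ξ in frequencySet hbar (Icc (-(W / 2)) (W / 2)), ‖(𝓕 e : L2R) ξ‖ ^ 2 =
      concentration (L * W / (4 * hbar)) f := by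
  have hpi := Real.pi_pos
  rw [frequencySet_Icc hbar_pos, IsPullback.setIntegral_fourier (half_pos hL) (by gcongr; linarith)
    (m := 0) (f := f)]
  · congr 1
    field_simp
    ring
  · convert he.isPullback hL using 1
    ring
  · simpa only [zero_sub, zero_add] using he.ae_eq_zero

/-- A frequency cutoff in the sense of `𝓕` is a momentum cutoff. -/
theorem isBandProjection_of_indicator (hbar_pos : 0 < hbar) {e g : L2R}
    (hg : (𝓕 g : L2R) =ᵐ[volume]
      (frequencySet hbar (Icc (-(W / 2)) (W / 2))).indicator (𝓕 e : L2R)) :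
    IsBandProjection hbar W e g := by
  have hpi := Real.pi_pos
  have hne : 2 * Real.pi * hbar ≠ 0 := by positivity
  filter_upwards [ae_comp_affine hg 0 (inv_ne_zero hne)] with p hp
  rw [zero_add, inv_mul_eq_div] at hp
  have hmem : p / (2 * Real.pi * hbar) ∈ frequencySet hbar (Icc (-(W / 2)) (W / 2)) ↔
      p ∈ Icc (-(W / 2)) (W / 2) := by
    rw [frequencySet, mem_preimage, mul_div_cancel₀ _ hne]
  rw [momentumWave, hp]
  by_cases h : p ∈ Icc (-(W / 2)) (W / 2)
  · rw [indicator_of_mem h, indicator_of_mem (hmem.2 h), momentumWave]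
  · rw [indicator_of_notMem h, indicator_of_notMem (mt hmem.1 h), mul_zero]

/-- Restricted to `[-L/2, L/2]`, the band projection of the principal eigenfunction is a multiple
of that eigenfunction. -/
theorem indicator_bandProjection_ae_eq (hbar_pos : 0 < hbar) (hL : 0 < L) (hW : 0 < W) {e g : L2R}
    (he : ‖e‖ = 1) (hsupp : ∀ᵐ x, x ∉ Icc (-(L / 2)) (L / 2) → e x = 0)
    (hg : (𝓕 g : L2R) =ᵐ[volume]
      (frequencySet hbar (Icc (-(W / 2)) (W / 2))).indicator (𝓕 e : L2R))
    (hgnorm : ‖g‖ ^ 2 = lambda0 (L * W / (4 * hbar)))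
    (hge : inner ℂ g e = (lambda0 (L * W / (4 * hbar)) : ℂ)) :
    (Icc (-(L / 2)) (L / 2)).indicator g =ᵐ[volume]
      ((lambda0 (L * W / (4 * hbar)) : ℂ) • e : L2R) := by
  have hJ : NullMeasurableSet (Icc (-(L / 2)) (L / 2)) (volume : Measure ℝ) :=
    measurableSet_Icc.nullMeasurableSet
  have hS := nullMeasurableSet_frequencySet hbar_pos
    (measurableSet_Icc (a := -(W / 2)) (b := W / 2)).nullMeasurableSet
  have hlam0 : 0 ≤ lambda0 (L * W / (4 * hbar)) := lambda0_nonneg (by positivity)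
  set lam := lambda0 (L * W / (4 * hbar)) with hlam
  obtain ⟨r, hr⟩ := exists_indicator hJ g
  have hrsupp : ∀ᵐ x, x ∉ Icc (-(L / 2)) (L / 2) → r x = 0 := by
    filter_upwards [hr] with x hx hx'
    rw [hx, indicator_of_notMem hx']
  have hre : inner ℂ r e = (lam : ℂ) := by
    rw [← hge, L2.inner_def, L2.inner_def]
    refine integral_congr_ae ?_
    filter_upwards [hr, hsupp] with x hx hx'
    rw [hx]
    by_cases h : x ∈ Icc (-(L / 2)) (L / 2)
    · rw [indicator_of_mem h]
    · rw [hx' h, inner_zero_right, inner_zero_right]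
  -- Here `⟨g, r⟩ = ‖r‖²`, and only the part of `r` in the band contributes to it. As in
  -- `isSlepianEigenfunction_of_max`, this and `⟨r, e⟩ = lam` force `r = lam • e`.
  have hr4 : (‖r‖ ^ 2) ^ 2 ≤ lam * (lam * ‖r‖ ^ 2) := by
    have h1 := norm_inner_indicator_sq_le hS hg (𝓕 r : L2R)
    rw [Lp.inner_fourier_eq, Lp.norm_fourier_eq, hgnorm, norm_inner_symm,
      inner_indicator_self hJ hr, Complex.norm_real, Real.norm_of_nonneg (by positivity)] at h1
    refine h1.trans (mul_le_mul_of_nonneg_left ?_ hlam0)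
    have h2 := setIntegral_fourier_le_lambda0 hbar_pos (by linarith : -(L / 2) < L / 2)
      (by linarith : -(W / 2) ≤ W / 2) hrsupp
    rwa [sub_neg_eq_add, sub_neg_eq_add, add_halves, add_halves] at h2
  have hr_le : ‖r‖ ^ 2 ≤ lam ^ 2 := by
    by_contra! h
    have := sq_nonneg lam
    nlinarith
  have hreq : r = (lam : ℂ) • e := by
    rw [← sub_eq_zero, ← norm_eq_zero, ← sq_eq_zero_iff (a := ‖_‖)]
    refine le_antisymm ?_ (by positivity)
    rw [@norm_sub_sq ℂ, inner_smul_right, hre, norm_smul, he, Complex.norm_real, mul_one,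
      Real.norm_eq_abs, sq_abs, ← Complex.ofReal_mul]
    simp only [RCLike.re_to_complex, Complex.ofReal_re]
    nlinarith
  rw [← hreq]
  exact hr.symm

theorem intervalWidth_le {w : ℝ → ℂ} {θ D : ℝ} (hD : 0 ≤ D)
    (h : θ ≤ ∫ x in Icc (-(D / 2)) (D / 2), ‖w x‖ ^ 2) :
    intervalWidth w θ ≤ ENNReal.ofReal D :=
  (isGLB_intervalWidth w θ).1 ⟨-(D / 2), D / 2, by linarith, h, by ring_nf⟩

/-- The angle addition formulas behind the saturating superposition. -/
theorem exists_saturating_coefficient {θx θp : ℝ} (hx : 0 < θx) (hx1 : θx ≤ 1) (hp : 0 < θp)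
    (hp1 : θp ≤ 1) (hsum : 1 < θx + θp) (hT : angularTarget θx θp < 1) :
    ∃ k : ℝ, k ^ 2 * (angularTarget θx θp * (1 - angularTarget θx θp)) = 1 ∧
      (√θx + √(1 - θx) * (k * (1 - angularTarget θx θp))) ^ 2 * angularTarget θx θp = θp := by
  have hτ := sqrt_mul_sub_sqrt_pos hx1 hp1 hsum
  rw [angularTarget] at hT ⊢
  rw [Real.sqrt_mul hx.le, Real.sqrt_mul (by linarith)] at hT hτ ⊢
  have hA := Real.sq_sqrt hx.le
  have hA' := Real.sq_sqrt (by linarith : 0 ≤ 1 - θx)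
  have hB := Real.sq_sqrt hp.le
  have hB' := Real.sq_sqrt (by linarith : 0 ≤ 1 - θp)
  have nA' := Real.sqrt_nonneg (1 - θx)
  have nB' := Real.sqrt_nonneg (1 - θp)
  have nA := Real.sqrt_nonneg θx
  have nB := Real.sqrt_nonneg θp
  generalize √θx = A at *
  generalize √(1 - θx) = A' at *
  generalize √θp = B at *
  generalize √(1 - θp) = B' at *
  -- With `A, A' = cos a, sin a` and `B, B' = cos b, sin b`, the two brackets are `cos(a+b)` and
  -- `sin(a+b)`.
  have hσ2 : 1 - (A * B - A' * B') ^ 2 = (A * B' + A' * B) ^ 2 := by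
    linear_combination (-(A' ^ 2) - A ^ 2) * hB + (-(A' ^ 2) - A ^ 2) * hB' - hA - hA'
  have hσ : 0 < A * B' + A' * B := by
    refine lt_of_le_of_ne (by positivity) fun h => ?_
    rw [← h] at hσ2
    linarith
  rw [hσ2]
  refine ⟨((A * B - A' * B') * (A * B' + A' * B))⁻¹, ?_, ?_⟩
  · rw [← mul_pow, inv_pow, inv_mul_cancel₀ (pow_ne_zero 2 (mul_pos hτ hσ).ne')]
  -- After multiplication by `cos(a+b)` this is `cos a cos(a+b) + sin a sin(a+b) = cos b`.
  have h1 : A + A' * (((A * B - A' * B') * (A * B' + A' * B))⁻¹ * (A * B' + A' * B) ^ 2) =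
      B / (A * B - A' * B') := by
    field_simp
    linear_combination B * hA + B * hA'
  rw [h1, div_pow, div_mul_cancel₀ _ (by positivity), hB]

end Saturation

/-- Only upper bounds on the widths are needed: equality follows from the lower bound on their
product by `eq_of_mul_le_mul`. -/
theorem exists_saturating_state {hbar θx θp L W : ℝ} (hbar_pos : 0 < hbar) (hx : 0 < θx)
    (hx1 : θx ≤ 1) (hp : 0 < θp) (hp1 : θp ≤ 1) (hsum : 1 < θx + θp) (hL : 0 < L) (hW : 0 < W)
    (hlam : lambda0 (L * W / (4 * hbar)) = angularTarget θx θp) {f : L2I} (hf : ‖f‖ = 1)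
    (heig : IsSlepianEigenfunction (L * W / (4 * hbar)) (lambda0 (L * W / (4 * hbar))) f) :
    ∃ ψ : L2R, IsSlepianSuperposition hbar L W θx f ψ ∧ ‖ψ‖ = 1 ∧
      intX ψ θx ≤ ENNReal.ofReal L ∧ intP hbar ψ θp ≤ ENNReal.ofReal W := by
  have hc : 0 ≤ L * W / (4 * hbar) := by positivity
  have hconc := heig.concentration_eq hc
  have hT1 : angularTarget θx θp < 1 := hlam ▸ lambda0_lt_one hc
  have hJ : NullMeasurableSet (Icc (-(L / 2)) (L / 2)) (volume : Measure ℝ) :=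
    measurableSet_Icc.nullMeasurableSet
  have hS := nullMeasurableSet_frequencySet hbar_pos
    (measurableSet_Icc (a := -(W / 2)) (b := W / 2)).nullMeasurableSet
  obtain ⟨e, he⟩ := exists_isRescaled hL f
  obtain ⟨g₀, hg₀⟩ := exists_indicator hS (𝓕 e : L2R)
  obtain ⟨g, rfl⟩ : ∃ g : L2R, (𝓕 g : L2R) = g₀ :=
    ⟨𝓕⁻ g₀, FourierTransform.fourier_fourierInv_eq g₀⟩
  have henorm : ‖e‖ = 1 := (he.norm_eq hL).trans hf
  have hgnorm : ‖g‖ ^ 2 = lambda0 (L * W / (4 * hbar)) := by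
    rw [← Lp.norm_fourier_eq, norm_sq_indicator hS hg₀, he.setIntegral_fourier hbar_pos hL hW,
      hconc, hf, one_pow, mul_one]
  have hge : inner ℂ g e = (lambda0 (L * W / (4 * hbar)) : ℂ) := by
    rw [← Lp.inner_fourier_eq, inner_indicator_self hS hg₀, Lp.norm_fourier_eq, hgnorm]
  have hPg := indicator_bandProjection_ae_eq hbar_pos hL hW henorm he.ae_eq_zero hg₀ hgnorm hge
  rw [hlam] at hgnorm hge hPg
  obtain ⟨k, hk1, hk2⟩ := exists_saturating_coefficient hx hx1 hp hp1 hsum hT1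
  have hT := angularTarget_pos hx1 hp1 hsum
  set T := angularTarget θx θp
  have heg : inner ℂ e g = (T : ℂ) := by
    rw [← inner_conj_symm, hge, Complex.conj_ofReal]
  have hee : inner ℂ e e = (1 : ℂ) := by
    rw [inner_self_eq_norm_sq_to_K, henorm]
    norm_num
  -- Gram–Schmidt: `‖g - Te‖² = T(1 - T)`, which `k` normalizes.
  let e' : L2R := (k : ℂ) • (g - (T : ℂ) • e)
  have horth : inner ℂ e e' = 0 := by
    simp only [e', inner_smul_right, inner_sub_right, heg, hee]
    ring
  have he'sq : ‖e'‖ ^ 2 = 1 := by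
    rw [norm_smul, mul_pow, Complex.norm_real, Real.norm_eq_abs, sq_abs, @norm_sub_sq ℂ,
      inner_smul_right, hge, norm_smul, henorm, Complex.norm_real, mul_one, Real.norm_eq_abs,
      sq_abs, hgnorm, ← Complex.ofReal_mul, ← hk1]
    simp only [RCLike.re_to_complex, Complex.ofReal_re]
    ring
  have he'norm : ‖e'‖ = 1 := (pow_eq_one_iff_of_nonneg (norm_nonneg _) two_ne_zero).1 he'sq
  let ψ : L2R := ((√θx : ℝ) : ℂ) • e + ((√(1 - θx) : ℝ) : ℂ) • e'
  have hψ : ‖ψ‖ = 1 := by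
    refine (pow_eq_one_iff_of_nonneg (norm_nonneg _) two_ne_zero).1 ?_
    rw [@norm_add_sq ℂ, inner_smul_left, inner_smul_right, horth, norm_smul, norm_smul, henorm,
      he'norm, Complex.norm_real, Complex.norm_real, mul_one, mul_one, Real.norm_eq_abs,
      Real.norm_eq_abs, sq_abs, sq_abs, Real.sq_sqrt hx.le, Real.sq_sqrt (by linarith)]
    simp
  -- On the interval `g = Te`, so `e'` vanishes there and `ψ` restricts to `√θx e`.
  have hXmass : ∫ x in Icc (-(L / 2)) (L / 2), ‖ψ x‖ ^ 2 = θx := by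
    have h1 : (((√θx : ℝ) : ℂ) • e : L2R) =ᵐ[volume] (Icc (-(L / 2)) (L / 2)).indicator ψ := by
      filter_upwards [hPg, he.ae_eq_zero, Lp.coeFn_smul ((√θx : ℝ) : ℂ) e,
        Lp.coeFn_add (((√θx : ℝ) : ℂ) • e) (((√(1 - θx) : ℝ) : ℂ) • e'),
        Lp.coeFn_smul ((√(1 - θx) : ℝ) : ℂ) e', Lp.coeFn_smul (k : ℂ) (g - (T : ℂ) • e),
        Lp.coeFn_sub g ((T : ℂ) • e)] with x h1 h2 h3 h4 h5 h6 h7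
      rw [h3, Pi.smul_apply]
      by_cases hxJ : x ∈ Icc (-(L / 2)) (L / 2)
      · rw [indicator_of_mem hxJ] at h1 ⊢
        rw [h4, Pi.add_apply, h3, h5, Pi.smul_apply, Pi.smul_apply, h6, Pi.smul_apply, h7,
          Pi.sub_apply, h1, sub_self, smul_zero, smul_zero, add_zero]
      · rw [indicator_of_notMem hxJ, h2 hxJ, smul_zero]
    rw [← norm_sq_indicator hJ h1, norm_smul, henorm, mul_one, Complex.norm_real,
      Real.norm_eq_abs, sq_abs, Real.sq_sqrt hx.le]
  have hPmass : ∫ p in Icc (-(W / 2)) (W / 2), ‖momentumWave hbar ψ p‖ ^ 2 = θp := by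
    rw [setIntegral_momentumWave hbar_pos ψ measurableSet_Icc.nullMeasurableSet]
    have hFψ : (𝓕 ψ : L2R) = ((√θx - √(1 - θx) * k * T : ℝ) : ℂ) • (𝓕 e : L2R) +
        ((√(1 - θx) * k : ℝ) : ℂ) • (𝓕 g : L2R) := by
      have h1 : ψ = ((√θx - √(1 - θx) * k * T : ℝ) : ℂ) • e +
          ((√(1 - θx) * k : ℝ) : ℂ) • g := by
        simp only [ψ, e']
        push_cast
        module
      rw [h1, FourierTransform.fourier_add, FourierTransform.fourier_smul,
        FourierTransform.fourier_smul]
    -- The band projection sends both `e` and `g` to `g`, hence `e'` to `k(1 - T)g`.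
    have h1 : (((√θx + √(1 - θx) * (k * (1 - T)) : ℝ) : ℂ) • (𝓕 g : L2R) : L2R) =ᵐ[volume]
        (frequencySet hbar (Icc (-(W / 2)) (W / 2))).indicator (𝓕 ψ : L2R) := by
      rw [hFψ]
      filter_upwards [hg₀, Lp.coeFn_smul ((√θx + √(1 - θx) * (k * (1 - T)) : ℝ) : ℂ) (𝓕 g : L2R),
        Lp.coeFn_add (((√θx - √(1 - θx) * k * T : ℝ) : ℂ) • (𝓕 e : L2R))
          (((√(1 - θx) * k : ℝ) : ℂ) • (𝓕 g : L2R)),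
        Lp.coeFn_smul ((√θx - √(1 - θx) * k * T : ℝ) : ℂ) (𝓕 e : L2R),
        Lp.coeFn_smul ((√(1 - θx) * k : ℝ) : ℂ) (𝓕 g : L2R)] with ξ h1 h2 h3 h4 h5
      rw [h2, Pi.smul_apply]
      by_cases hξ : ξ ∈ frequencySet hbar (Icc (-(W / 2)) (W / 2))
      · rw [indicator_of_mem hξ] at h1 ⊢
        rw [h3, Pi.add_apply, h4, h5, Pi.smul_apply, Pi.smul_apply, h1]
        simp only [smul_eq_mul]
        push_cast
        ring
      · rw [indicator_of_notMem hξ] at h1 ⊢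
        rw [h1, smul_zero]
    rw [← norm_sq_indicator hS h1, norm_smul, Lp.norm_fourier_eq, mul_pow, hgnorm,
      Complex.norm_real, Real.norm_eq_abs, sq_abs, hk2]
  refine ⟨ψ, ⟨e, g, e', he, isBandProjection_of_indicator hbar_pos hg₀, ?_, he'norm, horth, rfl⟩,
    hψ, intervalWidth_le hL.le hXmass.ge, intervalWidth_le hW.le hPmass.ge⟩
  refine Submodule.smul_mem _ _ (Submodule.sub_mem _ (Submodule.subset_span (by simp))
    (Submodule.smul_mem _ _ (Submodule.subset_span (by simp))))

theorem eq_of_mul_le_mul {a b A B : ℝ≥0∞} (ha : a ≤ A) (hb : b ≤ B) (hA0 : A ≠ 0) (hA : A ≠ ⊤)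
    (hB0 : B ≠ 0) (hB : B ≠ ⊤) (h : A * B ≤ a * b) : a = A ∧ b = B := by
  constructor
  · refine ha.eq_of_not_lt fun hlt => h.not_gt ?_
    calc a * b ≤ a * B := by gcongr
      _ < A * B := ENNReal.mul_lt_mul_left hB0 hB hlt
  · refine hb.eq_of_not_lt fun hlt => h.not_gt ?_
    calc a * b ≤ A * b := by gcongr
      _ < A * B := ENNReal.mul_lt_mul_right hA0 hA hlt

end ConfidenceUncertainty

end

/-! ### The main theorem -/

open ConfidenceUncertainty in
theorem theorem2 (hbar : ℝ) (hbar_pos : 0 < hbar) :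
    -- `λ₀(c)` is the largest eigenvalue of `K_c`, and `λ₀ : [0,∞) → [0,1)` is invertible
    (∀ c : ℝ, 0 ≤ c → IsGreatest (slepianEigenvalues c) (lambda0 c)) ∧
    StrictMonoOn lambda0 (Set.Ici 0) ∧
    Set.BijOn lambda0 (Set.Ici 0) (Set.Ico 0 1) ∧
    ∀ θx θp : ℝ, 0 < θx → θx ≤ 1 → 0 < θp → θp ≤ 1 → 1 < θx + θp →
      -- the bounds, for every state
      (∀ ψ : L2R, ‖ψ‖ = 1 →
        ENNReal.ofReal (2 * Real.pi * hbar * angularTarget θx θp)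
            ≤ confX ψ θx * confP hbar ψ θp ∧
        (intX ψ θx * intP hbar ψ θp ≠ ⊤ →
          angularTarget θx θp
            ≤ lambda0 ((intX ψ θx * intP hbar ψ θp).toReal / (4 * hbar))) ∧
        ENNReal.ofReal (4 * hbar) * lambda0Inv (angularTarget θx θp)
            ≤ intX ψ θx * intP hbar ψ θp) ∧
      -- saturation of the interval bound
      (∀ L W : ℝ, 0 < L → 0 < W →
        ENNReal.ofReal (L * W) = ENNReal.ofReal (4 * hbar) * lambda0Inv (angularTarget θx θp) →
        ∀ f : L2I, ‖f‖ = 1 →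
          IsSlepianEigenfunction (L * W / (4 * hbar)) (lambda0 (L * W / (4 * hbar))) f →
          ∃ ψ : L2R, IsSlepianSuperposition hbar L W θx f ψ ∧ ‖ψ‖ = 1 ∧
            intX ψ θx = ENNReal.ofReal L ∧ intP hbar ψ θp = ENNReal.ofReal W ∧
            intX ψ θx * intP hbar ψ θp
              = ENNReal.ofReal (4 * hbar) * lambda0Inv (angularTarget θx θp)) := by
  refine ⟨fun c hc => isGreatest_lambda0 hc, lambda0_strictMonoOn, lambda0_bijOn,
    fun θx θp hx hx1 hp hp1 hsum => ⟨fun ψ hψ =>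
      ⟨confX_mul_confP_ge hbar_pos hx hx1 hp hp1 hsum hψ,
        angularTarget_le_lambda0 hbar_pos hx hx1 hp hp1 hsum hψ,
        intX_mul_intP_ge hbar_pos hx hx1 hp hp1 hsum hψ⟩, ?_⟩⟩
  intro L W hL hW hLW f hf heig
  have h4 : 0 < 4 * hbar := by positivity
  -- Finiteness of `L * W` excludes the case `T = 1`.
  have htop : lambda0Inv (angularTarget θx θp) ≠ ⊤ := by
    intro h
    rw [h, ENNReal.mul_top (by simpa using h4)] at hLW
    exact ENNReal.ofReal_ne_top hLW
  obtain ⟨c, hc, hct, hc'⟩ := exists_lambda0_eq_of_lambda0Inv_ne_top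
    (angularTarget_pos hx1 hp1 hsum).le htop
  have hcLW : L * W / (4 * hbar) = c := by
    rw [hc', ← ENNReal.ofReal_mul h4.le, ENNReal.ofReal_eq_ofReal_iff (by positivity)
      (by positivity)] at hLW
    rw [hLW]
    field_simp
  obtain ⟨ψ, hψs, hψ, hX, hP⟩ := exists_saturating_state hbar_pos hx hx1 hp hp1 hsum hL hW
    (hcLW ▸ hct) hf heig
  have hge := intX_mul_intP_ge hbar_pos hx hx1 hp hp1 hsum hψ
  rw [← hLW, ENNReal.ofReal_mul hL.le] at hge
  obtain ⟨h1, h2⟩ := eq_of_mul_le_mul hX hP (by simpa using hL) ENNReal.ofReal_ne_top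
    (by simpa using hW) ENNReal.ofReal_ne_top hge
  exact ⟨ψ, hψs, hψ, h1, h2, by rw [h1, h2, ← hLW, ENNReal.ofReal_mul hL.le]⟩
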